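/- Let $w\in\mathfrak S_n$ be a permutation, written in one-line notation, such that $\{w(1),\dots,w(r)\}\neq\{1,\dots,r\}$ for all $1\le r<n$. Elnitsky's polygon $X(w)$ is the equilateral $2n$-gon whose sides are labeled $1,\dots,n,w(n),\dots,w(1)$ in counterclockwise order starting from the top vertex, where the first $n$ sides (the leftside boundary) form half of a convex $2n$-gon and sides with the same label are parallel; the sides labeled $w(1),\dots,w(n)$, from the top vertex to the bottom vertex, form the rightside boundary. A rhombic tiling of $X(w)$ is a tiling by rhombi whose edges are congruent and parallel to sides of $X(w)$; the labels of a tile are the labels of the sides to which its edges are parallel. A tile is a right-perimeter tile if it shares two consecutive edges with the rightside boundary of $X(w)$, and it is a forced right-perimeter tile for $w$ if it appears, as a right-perimeter tile, in every rhombic tiling of $X(w)$. Suppose that $x=w(k)$ and $y=w(k+1)$ are adjacent entries of $w$ with $x>y$. Then the following are equivalent: 1. there is a forced right-perimeter tile for $w$ with labels $\{x,y\}$; 2. $x$ and $y$ do not occur together in a $321$-pattern of $w$, i.e. there are no positions $a<b<c$ with $w(a)>w(b)>w(c)$ and $x,y\in\{w(a),w(b),w(c)\}$; 3. $x$ is a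 left-to-right maximum of $w$ (larger than every entry to its left) and $y$ is a right-to-left minimum of $w$ (smaller than every entry to its right). -/

import Mathlib

noncomputable section

namespace Elnitsky

/-- The unit edge vector with label `i`, of direction angle `θ i`. -/
def edgeVec {n : ℕ} (θ : Fin n → ℝ) (i : Fin n) : ℂ :=
  Complex.exp ((θ i : ℂ) * Complex.I)

/-- Admissible direction angles: the edges, in the order of their labels, all point downwards and
turn strictly counterclockwise. Starting from the top vertex and following the edge vectors
`0, 1, …, n - 1` one then traces half of a convex equilateral `2n`-gon, on its left side. -/
structure IsAdmissible {n : ℕ} (θ : Fin n → ℝ) : Prop where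
  strictMono : StrictMono θ
  mem_Ioo : ∀ i, θ i ∈ Set.Ioo Real.pi (2 * Real.pi)

/-- The `k`-th vertex of the descending path that starts at the top vertex `0` and whose successive
edges have the labels `σ 0, σ 1, …, σ (n - 1)`. -/
def pathVertex {n : ℕ} (θ : Fin n → ℝ) (σ : Equiv.Perm (Fin n)) (k : ℕ) : ℂ :=
  ∑ i ∈ Finset.univ.filter (fun i : Fin n => (i : ℕ) < k), edgeVec θ (σ i)

/-- The `k`-th edge (counted from `0` at the top) of that path, a segment with label `σ k`. -/
def pathEdge {n : ℕ} (θ : Fin n → ℝ) (σ : Equiv.Perm (Fin n)) (k : ℕ) : Set ℂ :=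
  segment ℝ (pathVertex θ σ k) (pathVertex θ σ (k + 1))

/-- The whole path, as a set of points. -/
def path {n : ℕ} (θ : Fin n → ℝ) (σ : Equiv.Perm (Fin n)) : Set ℂ :=
  ⋃ k : Fin n, pathEdge θ σ k

/-- The leftside boundary of `X(w)`: labels `0, 1, …, n - 1` from top to bottom. -/
def leftBoundary {n : ℕ} (θ : Fin n → ℝ) : Set ℂ := path θ (Equiv.refl (Fin n))

/-- The rightside boundary of `X(w)`: labels `w 0, w 1, …, w (n - 1)` from top to bottom. -/
def rightBoundary {n : ℕ} (θ : Fin n → ℝ) (w : Equiv.Perm (Fin n)) : Set ℂ := path θ w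

/-- Elnitsky's polygon `X(w)`, as a closed region. Both boundary paths descend strictly from the
top vertex to the bottom vertex, so the region they enclose consists of the points lying
horizontally between a point of the leftside and a point of the rightside boundary. -/
def polygon {n : ℕ} (θ : Fin n → ℝ) (w : Equiv.Perm (Fin n)) : Set ℂ :=
  {p | ∃ l ∈ leftBoundary θ, ∃ r ∈ rightBoundary θ w,
    l.im = p.im ∧ r.im = p.im ∧ l.re ≤ p.re ∧ p.re ≤ r.re}

/-- A rhombic tile: its top vertex, at any point of the plane, and the two distinct labels of its
edges, the smaller one first. -/
structure Tile (n : ℕ) where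
  top : ℂ
  lo : Fin n
  hi : Fin n
  lo_lt_hi : lo < hi

/-- The labels of a tile. -/
def Tile.labels {n : ℕ} (t : Tile n) : Finset (Fin n) := {t.lo, t.hi}

/-- The closed rhombus occupied by a tile. -/
def Tile.carrier {n : ℕ} (θ : Fin n → ℝ) (t : Tile n) : Set ℂ :=
  {p | ∃ a ∈ Set.Icc (0 : ℝ) 1, ∃ b ∈ Set.Icc (0 : ℝ) 1,
    p = t.top + a • edgeVec θ t.lo + b • edgeVec θ t.hi}

/-- The four edges of a tile. -/
def Tile.edges {n : ℕ} (θ : Fin n → ℝ) (t : Tile n) : Set (Set ℂ) :=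
  {segment ℝ t.top (t.top + edgeVec θ t.lo),
   segment ℝ t.top (t.top + edgeVec θ t.hi),
   segment ℝ (t.top + edgeVec θ t.lo) (t.top + edgeVec θ t.lo + edgeVec θ t.hi),
   segment ℝ (t.top + edgeVec θ t.hi) (t.top + edgeVec θ t.lo + edgeVec θ t.hi)}

/-- `T` is a rhombic tiling of `X(w)`: its tiles do not overlap and together fill `X(w)`. -/
structure IsRhombicTiling {n : ℕ} (θ : Fin n → ℝ) (w : Equiv.Perm (Fin n))
    (T : Finset (Tile n)) : Prop where
  nonoverlapping : ∀ s ∈ T, ∀ t ∈ T, s ≠ t →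
    Disjoint (interior (s.carrier θ)) (interior (t.carrier θ))
  covers : (⋃ t ∈ T, t.carrier θ) = polygon θ w

/-- The tile `t` shares two consecutive edges with the rightside boundary of `X(w)`. -/
def Tile.IsRightPerimeter {n : ℕ} (θ : Fin n → ℝ) (w : Equiv.Perm (Fin n)) (t : Tile n) : Prop :=
  ∃ k : ℕ, k + 1 < n ∧ pathEdge θ w k ∈ t.edges θ ∧ pathEdge θ w (k + 1) ∈ t.edges θ

/-- The tile `t` appears as a right-perimeter tile in every rhombic tiling of `X(w)`. -/
def Tile.IsForcedRightPerimeter {n : ℕ} (θ : Fin n → ℝ) (w : Equiv.Perm (Fin n))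
    (t : Tile n) : Prop :=
  ∀ T : Finset (Tile n), IsRhombicTiling θ w T → t ∈ T ∧ t.IsRightPerimeter θ w

/-- There is a forced right-perimeter tile with labels `{x, y}` for `w`. -/
def HasForcedRightPerimeterTile {n : ℕ} (θ : Fin n → ℝ) (w : Equiv.Perm (Fin n))
    (x y : Fin n) : Prop :=
  ∃ t : Tile n, t.labels = {x, y} ∧ t.IsForcedRightPerimeter θ w

/-- `w` does not map `{0, …, r - 1}` onto itself for any `0 < r < n`. -/
def FullySupported {n : ℕ} (w : Equiv.Perm (Fin n)) : Prop :=
  ∀ r : ℕ, 0 < r → r < n →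
    w '' {i : Fin n | (i : ℕ) < r} ≠ {i : Fin n | (i : ℕ) < r}

/-- The values `x` and `y` occur together in some `321`-pattern of `w`. -/
def TogetherIn321 {n : ℕ} (w : Equiv.Perm (Fin n)) (x y : Fin n) : Prop :=
  ∃ a b c : Fin n, a < b ∧ b < c ∧ w c < w b ∧ w b < w a ∧
    x ∈ ({w a, w b, w c} : Set (Fin n)) ∧ y ∈ ({w a, w b, w c} : Set (Fin n))

/-- The value `x` is a left-to-right maximum of `w`. -/
def IsLRMax {n : ℕ} (w : Equiv.Perm (Fin n)) (x : Fin n) : Prop :=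
  ∃ k : Fin n, w k = x ∧ ∀ j : Fin n, j < k → w j < x

/-- The value `y` is a right-to-left minimum of `w`. -/
def IsRLMin {n : ℕ} (w : Equiv.Perm (Fin n)) (y : Fin n) : Prop :=
  ∃ k : Fin n, w k = y ∧ ∀ j : Fin n, k < j → y < w j

end Elnitsky

end

/-!
An exchange at a descent of `w` replaces `w` by `w * swap i j` and cuts one rhombus, with two edges
on the rightside boundary, off `X(w)`. Conversely every tiling of `X(w)` contains such a rhombus:
a rightmost tile shares its two right edges with the rightside boundary. Hence tilings are peeled
off tile by tile, and tilings of `X(w)` with prescribed last tiles are built, by sequences of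
exchanges.

If `x` is a left-to-right maximum and `y` a right-to-left minimum, no exchange other than the one
of `x` and `y` moves them, so peeling any tiling must eventually remove the tile of `x` and `y`,
which therefore belonged to the tiling. If some entry to the left of `x` is larger than `x`, it can
be exchanged down to and past `x`, and the tiling built in this way covers the edge `x` by a tile
whose smaller label is `x`; an entry smaller than `y` to the right of `y` is treated in the same
way.

Intermediate polygons can degenerate, so the inductions run over coverings of the interior. All
regions are described as lying between two graphs over the vertical axis, which turns inclusions
and overlaps into inequalities.
-/

noncomputable section

namespace Elnitsky

open Set

/-! ### Regions between two graphs -/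

/-- The region of the plane enclosed between the graphs of `f` and `g`, both read as functions of
the height, over the heights in `[a, b]`. -/
def region (a b : ℝ) (f g : ℝ → ℝ) : Set ℂ :=
  {p | p.im ∈ Icc a b ∧ p.re ∈ Icc (f p.im) (g p.im)}

section Region

variable {a b : ℝ} {f f' g g' : ℝ → ℝ}

theorem mem_region {p : ℂ} :
    p ∈ region a b f g ↔ p.im ∈ Icc a b ∧ p.re ∈ Icc (f p.im) (g p.im) :=
  Iff.rfl

theorem isClosed_region (hf : Continuous f) (hg : Continuous g) :
    IsClosed (region a b f g) :=
  (isClosed_Icc.preimage Complex.continuous_im).inter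
    ((isClosed_le (hf.comp Complex.continuous_im) Complex.continuous_re).inter
      (isClosed_le Complex.continuous_re (hg.comp Complex.continuous_im)))

theorem region_congr (hf : EqOn f f' (Icc a b)) (hg : EqOn g g' (Icc a b)) :
    region a b f g = region a b f' g' := by
  ext p
  exact and_congr_right fun hp => by rw [hf hp, hg hp]

theorem mem_interior_region_iff (hf : Continuous f) (hg : Continuous g) {p : ℂ} :
    p ∈ interior (region a b f g) ↔ p.im ∈ Ioo a b ∧ p.re ∈ Ioo (f p.im) (g p.im) := by
  constructor
  · intro hp
    have him : p.im ∈ Ioo a b := by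
      rw [← interior_Icc, ← mem_preimage, ← Complex.interior_preimage_im]
      exact interior_mono (fun q hq => hq.1) hp
    have hslice : Continuous fun t : ℝ => (t + p.im * Complex.I : ℂ) := by fun_prop
    have hre : p.re ∈ interior (Icc (f p.im) (g p.im)) := by
      refine interior_mono (fun t ht => ?_)
        (preimage_interior_subset_interior_preimage hslice (t := region a b f g) ?_)
      · simpa using (mem_region.1 ht).2
      · simpa [Complex.re_add_im] using hp
    rw [interior_Icc] at hre
    exact ⟨him, hre⟩
  · have hopen : IsOpen {q : ℂ | q.im ∈ Ioo a b ∧ q.re ∈ Ioo (f q.im) (g q.im)} :=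
      (isOpen_Ioo.preimage Complex.continuous_im).inter
        ((isOpen_lt (hf.comp Complex.continuous_im) Complex.continuous_re).inter
          (isOpen_lt Complex.continuous_re (hg.comp Complex.continuous_im)))
    exact fun hp => interior_maximal (s := region a b f g)
      (fun q hq => ⟨Ioo_subset_Icc_self hq.1, Ioo_subset_Icc_self hq.2⟩) hopen hp

theorem region_subset_closure_interior (hf : Continuous f) (hg : Continuous g)
    (h : Icc a b ⊆ closure {y ∈ Ioo a b | f y < g y}) :
    region a b f g ⊆ closure (interior (region a b f g)) := by
  intro p hp
  set Φ : ℝ × ℝ → ℂ := fun z => AffineMap.lineMap (f z.1) (g z.1) z.2 + z.1 * Complex.I with hΦ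
  have hΦc : Continuous Φ := by
    simp only [hΦ, AffineMap.lineMap_apply_module]
    fun_prop
  obtain ⟨m, hm, hmp⟩ : p.re ∈ AffineMap.lineMap (f p.im) (g p.im) '' Icc (0 : ℝ) 1 := by
    rw [← segment_eq_image_lineMap, segment_eq_Icc (hp.2.1.trans hp.2.2)]
    exact hp.2
  have hmem : (p.im, m) ∈ closure ({y ∈ Ioo a b | f y < g y} ×ˢ Ioo (0 : ℝ) 1) := by
    rw [closure_prod_eq, closure_Ioo zero_ne_one]
    exact ⟨h hp.1, hm⟩
  have hp' : Φ (p.im, m) = p := by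
    simp only [hΦ, hmp, Complex.re_add_im]
  rw [← hp']
  refine closure_mono ?_ (image_closure_subset_closure_image hΦc (mem_image_of_mem Φ hmem))
  rintro _ ⟨⟨y, m⟩, ⟨⟨hy, hfg⟩, hm⟩, rfl⟩
  rw [mem_interior_region_iff hf hg]
  simp only [hΦ, Complex.add_re, Complex.add_im, Complex.ofReal_re, Complex.ofReal_im,
    Complex.re_ofReal_mul, Complex.im_ofReal_mul, Complex.I_re, Complex.I_im, mul_zero, mul_one,
    add_zero, zero_add]
  exact ⟨hy, (left_lt_lineMap_iff_lt hm.1).2 hfg, (lineMap_lt_right_iff_lt hm.2).2 hfg⟩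

end Region

/-! ### Clamping -/

/-- The real number `u`, clamped to the interval `[0, d]`. -/
def clamp (d u : ℝ) : ℝ := max 0 (min d u)

section Clamp

variable {d d' u v : ℝ}

theorem clamp_of_nonpos (hu : u ≤ 0) : clamp d u = 0 :=
  max_eq_left (min_le_of_right_le hu)

theorem clamp_of_le (hd : 0 ≤ d) (hu : d ≤ u) : clamp d u = d := by
  rw [clamp, min_eq_left hu, max_eq_right hd]

theorem clamp_of_mem (hu : u ∈ Icc 0 d) : clamp d u = u := by
  rw [clamp, min_eq_right hu.2, max_eq_right hu.1]

theorem monotone_clamp (d : ℝ) : Monotone (clamp d) :=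
  fun _ _ h => max_le_max_left 0 (min_le_min_left d h)

theorem continuous_clamp (d : ℝ) : Continuous (clamp d) := by
  unfold clamp
  fun_prop

theorem clamp_lt_clamp (hd : 0 < d) (hvu : v < u) (hu : 0 < u) (hv : v < d) :
    clamp d v < clamp d u :=
  max_lt (lt_max_of_lt_right (lt_min hd hu))
    (lt_max_of_lt_right (min_lt_of_right_lt (lt_min hv hvu)))

theorem clamp_add_clamp_sub (hd : 0 ≤ d) (hd' : 0 ≤ d') (u : ℝ) :
    clamp d u + clamp d' (u - d) = clamp (d + d') u := by
  unfold clamp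
  grind

end Clamp

/-! ### Edges and bends -/

section Edge

variable {n : ℕ} {θ : Fin n → ℝ} {i j : Fin n}

/-- The height lost along an edge with label `i`. -/
def edgeDrop (θ : Fin n → ℝ) (i : Fin n) : ℝ := -(edgeVec θ i).im

/-- The slope of an edge with label `i`: its horizontal displacement per unit of descent. -/
def edgeSlope (θ : Fin n → ℝ) (i : Fin n) : ℝ := (edgeVec θ i).re / edgeDrop θ i

theorem edgeVec_im (θ : Fin n → ℝ) (i : Fin n) : (edgeVec θ i).im = -edgeDrop θ i :=
  (neg_neg _).symm

theorem IsAdmissible.edgeDrop_pos (hθ : IsAdmissible θ) (i : Fin n) : 0 < edgeDrop θ i := by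
  obtain ⟨h1, h2⟩ := hθ.mem_Ioo i
  have : Real.sin (θ i - 2 * Real.pi) < 0 :=
    Real.sin_neg_of_neg_of_neg_pi_lt (by linarith) (by linarith)
  rwa [edgeDrop, edgeVec, Complex.exp_ofReal_mul_I_im, neg_pos, ← Real.sin_sub_two_pi]

theorem IsAdmissible.edgeVec_re (hθ : IsAdmissible θ) (i : Fin n) :
    (edgeVec θ i).re = edgeSlope θ i * edgeDrop θ i :=
  (div_mul_cancel₀ _ (hθ.edgeDrop_pos i).ne').symm

theorem IsAdmissible.strictMono_edgeSlope (hθ : IsAdmissible θ) : StrictMono (edgeSlope θ) := by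
  intro i j hij
  have hsin : 0 < Real.sin (θ j - θ i) := by
    have h1 := hθ.strictMono hij
    exact Real.sin_pos_of_pos_of_lt_pi (by linarith)
      (by linarith [(hθ.mem_Ioo i).1, (hθ.mem_Ioo j).2])
  rw [edgeSlope, edgeSlope, div_lt_div_iff₀ (hθ.edgeDrop_pos i) (hθ.edgeDrop_pos j)]
  simp only [edgeDrop, edgeVec, Complex.exp_ofReal_mul_I_re, Complex.exp_ofReal_mul_I_im]
  rw [Real.sin_sub] at hsin
  linarith

theorem IsAdmissible.mem_segment_edgeVec_iff (hθ : IsAdmissible θ) {p q : ℂ} :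
    p ∈ segment ℝ q (q + edgeVec θ i) ↔ p.im ∈ Icc (q.im - edgeDrop θ i) q.im ∧
      p.re = q.re + edgeSlope θ i * (q.im - p.im) := by
  have hd := hθ.edgeDrop_pos i
  rw [segment_eq_image']
  constructor
  · rintro ⟨a, ⟨ha0, ha1⟩, rfl⟩
    simp only [add_sub_cancel_left, Complex.add_im, Complex.add_re, Complex.real_smul,
      Complex.re_ofReal_mul, Complex.im_ofReal_mul, edgeVec_im, hθ.edgeVec_re]
    exact ⟨⟨by nlinarith, by nlinarith⟩, by ring⟩
  · rintro ⟨⟨h1, h2⟩, hre⟩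
    refine ⟨(q.im - p.im) / edgeDrop θ i,
      ⟨div_nonneg (by linarith) hd.le, (div_le_one hd).2 (by linarith)⟩, ?_⟩
    apply Complex.ext
    · simp only [add_sub_cancel_left, Complex.add_re, Complex.real_smul, Complex.re_ofReal_mul,
        hθ.edgeVec_re, hre]
      field_simp
    · simp only [add_sub_cancel_left, Complex.add_im, Complex.real_smul, Complex.im_ofReal_mul,
        edgeVec_im]
      field_simp
      ring

theorem IsAdmissible.exists_smul_add_smul_eq (hθ : IsAdmissible θ) (hij : i ≠ j) (p : ℂ) :
    ∃ a b : ℝ, a • edgeVec θ i + b • edgeVec θ j = p := by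
  have hi := (hθ.edgeDrop_pos i).ne'
  have hj := (hθ.edgeDrop_pos j).ne'
  have hs : edgeSlope θ j - edgeSlope θ i ≠ 0 :=
    sub_ne_zero.2 (hθ.strictMono_edgeSlope.injective.ne hij.symm)
  refine ⟨(-p.im * edgeSlope θ j - p.re) / (edgeDrop θ i * (edgeSlope θ j - edgeSlope θ i)),
    (p.re + p.im * edgeSlope θ i) / (edgeDrop θ j * (edgeSlope θ j - edgeSlope θ i)), ?_⟩
  apply Complex.ext
  · simp only [Complex.add_re, Complex.real_smul, Complex.re_ofReal_mul, hθ.edgeVec_re]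
    field_simp
    ring
  · simp only [Complex.add_im, Complex.real_smul, Complex.im_ofReal_mul, edgeVec_im]
    field_simp
    ring

/-- The horizontal displacement, after a descent by `u`, along the path that consists of an edge
with label `i` followed by one with label `j`, extended by constants. -/
def bend (θ : Fin n → ℝ) (i j : Fin n) (u : ℝ) : ℝ :=
  edgeSlope θ i * clamp (edgeDrop θ i) u + edgeSlope θ j * clamp (edgeDrop θ j) (u - edgeDrop θ i)

theorem continuous_bend (θ : Fin n → ℝ) (i j : Fin n) : Continuous (bend θ i j) := by
  have := continuous_clamp (edgeDrop θ i)
  have := continuous_clamp (edgeDrop θ j)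
  unfold bend
  fun_prop

theorem IsAdmissible.bend_sub_bend (hθ : IsAdmissible θ) (i j : Fin n) (u : ℝ) :
    bend θ j i u - bend θ i j u = (edgeSlope θ j - edgeSlope θ i) *
      (clamp (edgeDrop θ j) u - clamp (edgeDrop θ j) (u - edgeDrop θ i)) := by
  have h1 := clamp_add_clamp_sub (hθ.edgeDrop_pos i).le (hθ.edgeDrop_pos j).le u
  have h2 := clamp_add_clamp_sub (hθ.edgeDrop_pos j).le (hθ.edgeDrop_pos i).le u
  rw [add_comm (edgeDrop θ j)] at h2
  unfold bend
  linear_combination edgeSlope θ i * (h2 - h1)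

theorem IsAdmissible.bend_le_bend (hθ : IsAdmissible θ) (hij : i < j) (u : ℝ) :
    bend θ i j u ≤ bend θ j i u := by
  rw [← sub_nonneg, hθ.bend_sub_bend]
  exact mul_nonneg (sub_nonneg.2 (hθ.strictMono_edgeSlope hij).le)
    (sub_nonneg.2 (monotone_clamp _ (sub_le_self u (hθ.edgeDrop_pos i).le)))

theorem IsAdmissible.bend_lt_bend (hθ : IsAdmissible θ) (hij : i < j) {u : ℝ}
    (hu : u ∈ Ioo 0 (edgeDrop θ i + edgeDrop θ j)) : bend θ i j u < bend θ j i u := by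
  rw [← sub_pos, hθ.bend_sub_bend]
  exact mul_pos (sub_pos.2 (hθ.strictMono_edgeSlope hij))
    (sub_pos.2 (clamp_lt_clamp (hθ.edgeDrop_pos j) (sub_lt_self u (hθ.edgeDrop_pos i)) hu.1
      (sub_lt_iff_lt_add'.2 hu.2)))

theorem IsAdmissible.bend_eq_bend (hθ : IsAdmissible θ) (i j : Fin n) {u : ℝ}
    (hu : u ∉ Ioo 0 (edgeDrop θ i + edgeDrop θ j)) : bend θ i j u = bend θ j i u := by
  have hi := hθ.edgeDrop_pos i
  have hj := hθ.edgeDrop_pos j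
  rw [eq_comm, ← sub_eq_zero, hθ.bend_sub_bend]
  rcases le_or_gt u 0 with h0 | h0
  · rw [clamp_of_nonpos h0, clamp_of_nonpos (by linarith), sub_self, mul_zero]
  · have hu' : edgeDrop θ i + edgeDrop θ j ≤ u := le_of_not_gt fun h => hu ⟨h0, h⟩
    rw [clamp_of_le hj.le (by linarith), clamp_of_le hj.le (by linarith), sub_self, mul_zero]

theorem IsAdmissible.smul_add_smul_re_sub_bend (hθ : IsAdmissible θ) {a b : ℝ}
    (hu : a * edgeDrop θ i + b * edgeDrop θ j ∈ Icc 0 (edgeDrop θ i + edgeDrop θ j)) :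
    (a • edgeVec θ i + b • edgeVec θ j).re - bend θ i j (a * edgeDrop θ i + b * edgeDrop θ j) =
      (edgeSlope θ j - edgeSlope θ i) *
        (clamp (edgeDrop θ i) (a * edgeDrop θ i + b * edgeDrop θ j) - a * edgeDrop θ i) := by
  have h := clamp_add_clamp_sub (hθ.edgeDrop_pos i).le (hθ.edgeDrop_pos j).le
    (a * edgeDrop θ i + b * edgeDrop θ j)
  rw [clamp_of_mem hu] at h
  simp only [bend, Complex.add_re, Complex.real_smul, Complex.re_ofReal_mul, hθ.edgeVec_re]
  linear_combination -edgeSlope θ j * h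

theorem mul_le_clamp_iff {d d' a b : ℝ} (hd : 0 < d) (hd' : 0 < d') (hu : 0 ≤ a * d + b * d') :
    a * d ≤ clamp d (a * d + b * d') ↔ a ≤ 1 ∧ 0 ≤ b := by
  have hb : a * d ≤ a * d + b * d' ↔ 0 ≤ b := by
    rw [le_add_iff_nonneg_right, mul_nonneg_iff_of_pos_right hd']
  rw [clamp, le_max_iff, le_min_iff, mul_le_iff_le_one_left hd, hb, or_iff_right_iff_imp]
  intro ha
  exact ⟨by nlinarith, hb.1 (ha.trans hu)⟩

theorem IsAdmissible.bend_le_iff (hθ : IsAdmissible θ) (hij : i < j) {a b : ℝ}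
    (hu : a * edgeDrop θ i + b * edgeDrop θ j ∈ Icc 0 (edgeDrop θ i + edgeDrop θ j)) :
    bend θ i j (a * edgeDrop θ i + b * edgeDrop θ j) ≤ (a • edgeVec θ i + b • edgeVec θ j).re ↔
      a ≤ 1 ∧ 0 ≤ b := by
  rw [← sub_nonneg, hθ.smul_add_smul_re_sub_bend hu,
    mul_nonneg_iff_of_pos_left (sub_pos.2 (hθ.strictMono_edgeSlope hij)), sub_nonneg,
    mul_le_clamp_iff (hθ.edgeDrop_pos i) (hθ.edgeDrop_pos j) hu.1]

theorem IsAdmissible.le_bend_iff (hθ : IsAdmissible θ) (hji : j < i) {a b : ℝ}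
    (hu : a * edgeDrop θ i + b * edgeDrop θ j ∈ Icc 0 (edgeDrop θ i + edgeDrop θ j)) :
    (a • edgeVec θ i + b • edgeVec θ j).re ≤ bend θ i j (a * edgeDrop θ i + b * edgeDrop θ j) ↔
      a ≤ 1 ∧ 0 ≤ b := by
  rw [← sub_nonneg, ← neg_sub, hθ.smul_add_smul_re_sub_bend hu, ← neg_mul, neg_sub,
    mul_nonneg_iff_of_pos_left (sub_pos.2 (hθ.strictMono_edgeSlope hji)), sub_nonneg,
    mul_le_clamp_iff (hθ.edgeDrop_pos i) (hθ.edgeDrop_pos j) hu.1]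

end Edge

/-! ### Tiles as regions between two bends -/

namespace Tile

variable {n : ℕ} {θ : Fin n → ℝ}

/-- The height of the bottom vertex of a tile. -/
def bottom (θ : Fin n → ℝ) (t : Tile n) : ℝ :=
  t.top.im - (edgeDrop θ t.lo + edgeDrop θ t.hi)

/-- The left boundary of a tile, as a function of the height. -/
def leftRe (θ : Fin n → ℝ) (t : Tile n) (h : ℝ) : ℝ := t.top.re + bend θ t.lo t.hi (t.top.im - h)

/-- The right boundary of a tile, as a function of the height. -/
def rightRe (θ : Fin n → ℝ) (t : Tile n) (h : ℝ) : ℝ := t.top.re + bend θ t.hi t.lo (t.top.im - h)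

theorem continuous_leftRe (t : Tile n) : Continuous (t.leftRe θ) := by
  have := continuous_bend θ t.lo t.hi
  unfold leftRe
  fun_prop

theorem continuous_rightRe (t : Tile n) : Continuous (t.rightRe θ) := by
  have := continuous_bend θ t.hi t.lo
  unfold rightRe
  fun_prop

theorem bottom_lt_top (hθ : IsAdmissible θ) (t : Tile n) : t.bottom θ < t.top.im :=
  sub_lt_self _ (add_pos (hθ.edgeDrop_pos _) (hθ.edgeDrop_pos _))

theorem leftRe_lt_rightRe (hθ : IsAdmissible θ) (t : Tile n) {h : ℝ}
    (hh : h ∈ Ioo (t.bottom θ) t.top.im) : t.leftRe θ h < t.rightRe θ h :=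
  add_lt_add_right (hθ.bend_lt_bend t.lo_lt_hi ⟨sub_pos.2 hh.2, sub_lt_comm.1 hh.1⟩) _

theorem add_smul_add_smul_mem_region_iff (hθ : IsAdmissible θ) (t : Tile n) {a b : ℝ} :
    t.top + (a • edgeVec θ t.lo + b • edgeVec θ t.hi) ∈
        region (t.bottom θ) t.top.im (t.leftRe θ) (t.rightRe θ) ↔
      a ∈ Icc (0 : ℝ) 1 ∧ b ∈ Icc (0 : ℝ) 1 := by
  have hlo := hθ.edgeDrop_pos t.lo
  have hhi := hθ.edgeDrop_pos t.hi
  set u := a * edgeDrop θ t.lo + b * edgeDrop θ t.hi with hu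
  have him : (t.top + (a • edgeVec θ t.lo + b • edgeVec θ t.hi)).im = t.top.im - u := by
    simp only [Complex.add_im, Complex.real_smul, Complex.im_ofReal_mul, edgeVec_im]
    ring
  have hheight : t.top.im - u ∈ Icc (t.bottom θ) t.top.im ↔
      u ∈ Icc 0 (edgeDrop θ t.lo + edgeDrop θ t.hi) := by
    rw [bottom, mem_Icc, sub_le_sub_iff_left, sub_le_self_iff, and_comm, mem_Icc]
  have hside : u ∈ Icc 0 (edgeDrop θ t.lo + edgeDrop θ t.hi) →
      ((t.top + (a • edgeVec θ t.lo + b • edgeVec θ t.hi)).re ∈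
        Icc (t.leftRe θ (t.top.im - u)) (t.rightRe θ (t.top.im - u)) ↔
      (a ≤ 1 ∧ 0 ≤ b) ∧ b ≤ 1 ∧ 0 ≤ a) := fun h => by
    have hleft := hθ.bend_le_iff t.lo_lt_hi h
    have hright := hθ.le_bend_iff (a := b) (b := a) t.lo_lt_hi
      (by rwa [add_comm (b * _), add_comm (edgeDrop θ t.hi)])
    rw [add_comm (b * _), ← hu, add_comm (b • _)] at hright
    rw [leftRe, rightRe, sub_sub_cancel, Complex.add_re, mem_Icc, add_le_add_iff_left,
      add_le_add_iff_left, hleft, hright]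
  rw [mem_region, him, hheight, and_congr_right hside]
  constructor
  · rintro ⟨-, ⟨ha1, hb0⟩, hb1, ha0⟩
    exact ⟨⟨ha0, ha1⟩, hb0, hb1⟩
  · rintro ⟨⟨ha0, ha1⟩, hb0, hb1⟩
    exact ⟨⟨by positivity, by nlinarith⟩, ⟨ha1, hb0⟩, hb1, ha0⟩

theorem carrier_eq_region (hθ : IsAdmissible θ) (t : Tile n) :
    t.carrier θ = region (t.bottom θ) t.top.im (t.leftRe θ) (t.rightRe θ) := by
  ext p
  constructor
  · rintro ⟨a, ha, b, hb, rfl⟩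
    rw [add_assoc]
    exact (t.add_smul_add_smul_mem_region_iff hθ).2 ⟨ha, hb⟩
  · intro hp
    obtain ⟨a, b, hab⟩ := hθ.exists_smul_add_smul_eq t.lo_lt_hi.ne (p - t.top)
    rw [← add_sub_cancel t.top p, ← hab, t.add_smul_add_smul_mem_region_iff hθ] at hp
    exact ⟨a, hp.1, b, hp.2, by rw [add_assoc, hab, add_sub_cancel]⟩

theorem isClosed_carrier (hθ : IsAdmissible θ) (t : Tile n) : IsClosed (t.carrier θ) := by
  rw [t.carrier_eq_region hθ]
  exact isClosed_region t.continuous_leftRe t.continuous_rightRe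

theorem convex_carrier (t : Tile n) : Convex ℝ (t.carrier θ) := by
  rintro p ⟨a, ha, b, hb, rfl⟩ q ⟨a', ha', b', hb', rfl⟩ x y hx hy hxy
  refine ⟨x • a + y • a', convex_Icc 0 1 ha ha' hx hy hxy, x • b + y • b',
    convex_Icc 0 1 hb hb' hx hy hxy, ?_⟩
  have hxy' : (x + y : ℂ) = 1 := mod_cast hxy
  simp only [Complex.real_smul, Complex.ofReal_add, smul_eq_mul, Complex.ofReal_mul]
  linear_combination t.top * hxy'

theorem mem_interior_carrier_iff (hθ : IsAdmissible θ) (t : Tile n) {p : ℂ} :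
    p ∈ interior (t.carrier θ) ↔
      p.im ∈ Ioo (t.bottom θ) t.top.im ∧ p.re ∈ Ioo (t.leftRe θ p.im) (t.rightRe θ p.im) := by
  rw [t.carrier_eq_region hθ,
    mem_interior_region_iff t.continuous_leftRe t.continuous_rightRe]

theorem carrier_subset_closure_interior (hθ : IsAdmissible θ) (t : Tile n) :
    t.carrier θ ⊆ closure (interior (t.carrier θ)) := by
  rw [t.carrier_eq_region hθ]
  refine region_subset_closure_interior t.continuous_leftRe t.continuous_rightRe ?_
  rw [sep_eq_self_iff_mem_true.2 fun h hh => t.leftRe_lt_rightRe hθ hh,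
    closure_Ioo (t.bottom_lt_top hθ).ne]

theorem exists_mem_interior_carrier (hθ : IsAdmissible θ) (t : Tile n) {h : ℝ}
    (hh : h ∈ Ioo (t.bottom θ) t.top.im) : ∃ p ∈ interior (t.carrier θ), p.im = h := by
  obtain ⟨x, hx⟩ := exists_between (t.leftRe_lt_rightRe hθ hh)
  exact ⟨⟨x, h⟩, (t.mem_interior_carrier_iff hθ).2 ⟨hh, hx⟩, rfl⟩

theorem mem_rightRe_of_mem_segment_hi (hθ : IsAdmissible θ) (t : Tile n) {p : ℂ}
    (hp : p ∈ segment ℝ t.top (t.top + edgeVec θ t.hi)) :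
    p.im ∈ Icc (t.bottom θ) t.top.im ∧ p.re = t.rightRe θ p.im := by
  have hlo := hθ.edgeDrop_pos t.lo
  obtain ⟨⟨hbot, htop⟩, hre⟩ := hθ.mem_segment_edgeVec_iff.1 hp
  refine ⟨⟨by rw [bottom]; linarith, htop⟩, ?_⟩
  rw [hre, rightRe, bend, clamp_of_mem ⟨by linarith, by linarith⟩, clamp_of_nonpos (by linarith),
    mul_zero, add_zero]

theorem mem_rightRe_of_mem_segment_lo (hθ : IsAdmissible θ) (t : Tile n) {p : ℂ}
    (hp : p ∈ segment ℝ (t.top + edgeVec θ t.hi) (t.top + edgeVec θ t.hi + edgeVec θ t.lo)) :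
    p.im ∈ Icc (t.bottom θ) t.top.im ∧ p.re = t.rightRe θ p.im := by
  have hhi := hθ.edgeDrop_pos t.hi
  obtain ⟨⟨hbot, htop⟩, hre⟩ := hθ.mem_segment_edgeVec_iff.1 hp
  rw [Complex.add_im, edgeVec_im] at hbot htop hre
  refine ⟨⟨by rw [bottom]; linarith, by linarith⟩, ?_⟩
  rw [hre, rightRe, bend, clamp_of_le hhi.le (by linarith),
    clamp_of_mem ⟨by linarith, by linarith⟩, Complex.add_re, hθ.edgeVec_re]
  ring

end Tile

/-! ### Descending paths as graphs -/

section Path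

variable {n : ℕ} {θ : Fin n → ℝ} (σ : Equiv.Perm (Fin n))

theorem pathVertex_zero : pathVertex θ σ 0 = 0 := by
  simp [pathVertex]

theorem pathVertex_succ (i : Fin n) :
    pathVertex θ σ (i + 1) = pathVertex θ σ i + edgeVec θ (σ i) := by
  have : Finset.univ.filter (fun l : Fin n => (l : ℕ) < i + 1) =
      insert i (Finset.univ.filter fun l : Fin n => (l : ℕ) < i) := by
    ext l
    simp only [Finset.mem_filter, Finset.mem_univ, true_and, Finset.mem_insert, Fin.ext_iff]
    omega
  rw [pathVertex, this, Finset.sum_insert (by simp), add_comm, pathVertex]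

theorem pathEdge_eq_segment (i : Fin n) :
    pathEdge θ σ i = segment ℝ (pathVertex θ σ i) (pathVertex θ σ i + edgeVec θ (σ i)) := by
  rw [pathEdge, pathVertex_succ]

theorem pathEdge_subset_path (i : Fin n) : pathEdge θ σ i ⊆ path θ σ :=
  subset_iUnion (fun k : Fin n => pathEdge θ σ k) i

/-- The height of the `k`-th vertex of a descending path. -/
def level (θ : Fin n → ℝ) (σ : Equiv.Perm (Fin n)) (k : ℕ) : ℝ := (pathVertex θ σ k).im

/-- The height of the common bottom vertex of all descending paths. -/
def pathBottom (θ : Fin n → ℝ) : ℝ := -∑ i, edgeDrop θ i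

theorem level_zero : level θ σ 0 = 0 := by
  rw [level, pathVertex_zero, Complex.zero_im]

theorem level_succ (i : Fin n) : level θ σ (i + 1) = level θ σ i - edgeDrop θ (σ i) := by
  rw [level, pathVertex_succ, Complex.add_im, edgeVec_im, level, sub_eq_add_neg]

theorem level_length : level θ σ n = pathBottom θ := by
  rw [level, pathVertex, Finset.filter_true_of_mem fun i _ => i.2,
    Equiv.sum_comp σ (edgeVec θ), Complex.im_sum, pathBottom, ← Finset.sum_neg_distrib]
  exact Finset.sum_congr rfl fun i _ => edgeVec_im θ i

theorem IsAdmissible.level_succ_lt (hθ : IsAdmissible θ) (i : Fin n) :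
    level θ σ (i + 1) < level θ σ i := by
  rw [level_succ]
  exact sub_lt_self _ (hθ.edgeDrop_pos _)

theorem IsAdmissible.strictAntiOn_level (hθ : IsAdmissible θ) :
    StrictAntiOn (level θ σ) (Iic n) :=
  strictAntiOn_Iic_of_succ_lt fun k hk => hθ.level_succ_lt σ ⟨k, hk⟩

theorem IsAdmissible.level_mem_Icc (hθ : IsAdmissible θ) {k : ℕ} (hk : k ≤ n) :
    level θ σ k ∈ Icc (pathBottom θ) 0 := by
  have hanti := (hθ.strictAntiOn_level σ).antitoneOn
  rw [← level_length σ, ← level_zero (θ := θ) σ]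
  exact ⟨hanti hk self_mem_Iic hk, hanti (Nat.zero_le n) hk (Nat.zero_le k)⟩

theorem exists_mem_Ioc_level {h : ℝ} (hh : h ∈ Ioc (pathBottom θ) 0) :
    ∃ k : Fin n, h ∈ Ioc (level θ σ (k + 1)) (level θ σ k) := by
  by_contra! hcon
  have hle : ∀ k ≤ n, h ≤ level θ σ k := by
    intro k
    induction k with
    | zero => exact fun _ => hh.2.trans_eq (level_zero σ).symm
    | succ k ih =>
      exact fun hk => le_of_not_gt fun hlt => hcon ⟨k, hk⟩ ⟨hlt, ih (Nat.le_of_succ_le hk)⟩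
  exact (hle n le_rfl).not_gt (level_length σ ▸ hh.1)

theorem IsAdmissible.exists_mem_Icc_level [NeZero n] (hθ : IsAdmissible θ) {h : ℝ}
    (hh : h ∈ Icc (pathBottom θ) 0) :
    ∃ k : Fin n, h ∈ Icc (level θ σ (k + 1)) (level θ σ k) := by
  rcases hh.1.eq_or_lt with rfl | hlt
  · obtain ⟨m, rfl⟩ := Nat.exists_eq_succ_of_ne_zero (NeZero.ne n)
    have hlast : level θ σ (Fin.last m + 1) = pathBottom θ := level_length σ
    exact ⟨Fin.last m, hlast.le, hlast ▸ (hθ.level_succ_lt σ (Fin.last m)).le⟩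
  · obtain ⟨k, hk⟩ := exists_mem_Ioc_level σ ⟨hlt, hh.2⟩
    exact ⟨k, Ioc_subset_Icc_self hk⟩

/-- The horizontal coordinate of the point of a descending path at height `h`, extended by
constants above its top and below its bottom vertex. -/
def pathRe (θ : Fin n → ℝ) (σ : Equiv.Perm (Fin n)) (h : ℝ) : ℝ :=
  ∑ i, edgeSlope θ (σ i) * clamp (edgeDrop θ (σ i)) (level θ σ i - h)

theorem continuous_pathRe : Continuous (pathRe θ σ) := by
  have := fun i => continuous_clamp (edgeDrop θ (σ i))
  unfold pathRe
  fun_prop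

theorem IsAdmissible.pathRe_of_mem_Icc (hθ : IsAdmissible θ) {i : Fin n} {h : ℝ}
    (hh : h ∈ Icc (level θ σ (i + 1)) (level θ σ i)) :
    pathRe θ σ h = (pathVertex θ σ i).re + edgeSlope θ (σ i) * (level θ σ i - h) := by
  have hanti := (hθ.strictAntiOn_level σ).antitoneOn
  have hlast : edgeSlope θ (σ i) * (level θ σ i - h) =
      ∑ l, if l = i then edgeSlope θ (σ i) * (level θ σ i - h) else 0 := by
    rw [Finset.sum_ite_eq', if_pos (Finset.mem_univ i)]
  rw [pathRe, pathVertex, Complex.re_sum, Finset.sum_filter, hlast, ← Finset.sum_add_distrib]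
  refine Finset.sum_congr rfl fun l _ => ?_
  rcases lt_trichotomy l i with hli | rfl | hil
  · have : level θ σ i ≤ level θ σ l - edgeDrop θ (σ l) := by
      rw [← level_succ]
      exact hanti l.2 i.2.le hli
    rw [if_pos (Fin.lt_def.1 hli), if_neg hli.ne, add_zero, hθ.edgeVec_re,
      clamp_of_le (hθ.edgeDrop_pos _).le (by linarith [hh.2])]
  · rw [level_succ] at hh
    rw [if_neg (lt_irrefl _), if_pos rfl, zero_add,
      clamp_of_mem ⟨by linarith [hh.2], by linarith [hh.1]⟩]
  · have : level θ σ l ≤ level θ σ (i + 1) := hanti i.2 l.2.le hil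
    rw [if_neg (Fin.lt_def.not.1 hil.not_gt), if_neg hil.ne', add_zero,
      clamp_of_nonpos (by linarith [hh.1]), mul_zero]

theorem IsAdmissible.mem_pathEdge_iff (hθ : IsAdmissible θ) {i : Fin n} {p : ℂ} :
    p ∈ pathEdge θ σ i ↔
      p.im ∈ Icc (level θ σ (i + 1)) (level θ σ i) ∧ p.re = pathRe θ σ p.im := by
  rw [pathEdge_eq_segment, hθ.mem_segment_edgeVec_iff, level_succ]
  refine and_congr_right fun hp => ?_
  rw [hθ.pathRe_of_mem_Icc σ (level_succ (θ := θ) σ i ▸ hp), level]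

theorem IsAdmissible.mem_path_iff [NeZero n] (hθ : IsAdmissible θ) {p : ℂ} :
    p ∈ path θ σ ↔ p.im ∈ Icc (pathBottom θ) 0 ∧ p.re = pathRe θ σ p.im := by
  simp only [path, mem_iUnion, hθ.mem_pathEdge_iff σ, exists_and_right]
  refine and_congr_left fun _ => ⟨?_, hθ.exists_mem_Icc_level σ⟩
  rintro ⟨k, hk⟩
  exact ⟨(hθ.level_mem_Icc σ k.2).1.trans hk.1, hk.2.trans (hθ.level_mem_Icc σ k.2.le).2⟩

theorem IsAdmissible.polygon_eq_region [NeZero n] (hθ : IsAdmissible θ)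
    (w : Equiv.Perm (Fin n)) :
    polygon θ w = region (pathBottom θ) 0 (pathRe θ 1) (pathRe θ w) := by
  ext p
  constructor
  · rintro ⟨l, hl, r, hr, hlp, hrp, hlre, hrre⟩
    obtain ⟨hp, hl⟩ := (hθ.mem_path_iff _).1 hl
    obtain ⟨-, hr⟩ := (hθ.mem_path_iff _).1 hr
    rw [hlp] at hp hl
    rw [hrp] at hr
    exact ⟨hp, hl ▸ hlre, hr ▸ hrre⟩
  · rintro ⟨hp, hlre, hrre⟩
    exact ⟨⟨pathRe θ 1 p.im, p.im⟩, (hθ.mem_path_iff _).2 ⟨hp, rfl⟩,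
      ⟨pathRe θ w p.im, p.im⟩, (hθ.mem_path_iff _).2 ⟨hp, rfl⟩, rfl, rfl, hlre, hrre⟩

theorem IsAdmissible.isClosed_polygon [NeZero n] (hθ : IsAdmissible θ)
    (w : Equiv.Perm (Fin n)) : IsClosed (polygon θ w) := by
  rw [hθ.polygon_eq_region]
  exact isClosed_region (continuous_pathRe 1) (continuous_pathRe w)

theorem IsAdmissible.injective_pathEdge (hθ : IsAdmissible θ) :
    Function.Injective fun i : Fin n => pathEdge θ σ i := by
  have hlevel : ∀ i l : Fin n, pathEdge θ σ i ⊆ pathEdge θ σ l → level θ σ i ≤ level θ σ l :=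
    fun i l h => ((hθ.mem_pathEdge_iff σ).1 (h (left_mem_segment ℝ _ _))).1.2
  intro i l h
  exact Fin.ext ((hθ.strictAntiOn_level σ).injOn i.2.le l.2.le
    ((hlevel i l h.subset).antisymm (hlevel l i h.superset)))

theorem IsAdmissible.pathRe_of_segment_subset_path (hθ : IsAdmissible θ) {q : ℂ} {i : Fin n}
    (hq : segment ℝ q (q + edgeVec θ i) ⊆ path θ σ) {h : ℝ}
    (hh : h ∈ Icc (q.im - edgeDrop θ i) q.im) :
    h ∈ Icc (pathBottom θ) 0 ∧ pathRe θ σ h = q.re + edgeSlope θ i * (q.im - h) := by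
  have : NeZero n := ⟨i.pos.ne'⟩
  have hmem : (⟨q.re + edgeSlope θ i * (q.im - h), h⟩ : ℂ) ∈ segment ℝ q (q + edgeVec θ i) :=
    hθ.mem_segment_edgeVec_iff.2 ⟨hh, rfl⟩
  obtain ⟨hh', hre⟩ := (hθ.mem_path_iff σ).1 (hq hmem)
  exact ⟨hh', hre.symm⟩

/- An edge that overlaps the path in a nondegenerate segment has the slope, hence the label, of the
path edge that it overlaps there; each label occurs on the path only once. -/
theorem IsAdmissible.Ioc_subset_of_segment_subset_path (hθ : IsAdmissible θ) {q : ℂ} {i : Fin n}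
    (hq : segment ℝ q (q + edgeVec θ (σ i)) ⊆ path θ σ) :
    Ioc (q.im - edgeDrop θ (σ i)) q.im ⊆ Ioc (level θ σ (i + 1)) (level θ σ i) := by
  intro h hh
  have hd := hθ.edgeDrop_pos (σ i)
  have hbot := (hθ.pathRe_of_segment_subset_path σ hq (left_mem_Icc.2 (sub_le_self _ hd.le))).1.1
  obtain ⟨htop, hre⟩ := hθ.pathRe_of_segment_subset_path σ hq (Ioc_subset_Icc_self hh)
  obtain ⟨l, hl⟩ := exists_mem_Ioc_level σ ⟨hbot.trans_lt hh.1, htop.2⟩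
  set h' := max (level θ σ (l + 1)) (q.im - edgeDrop θ (σ i))
  have hlt : h' < h := max_lt hl.1 hh.1
  have hre' :=
    (hθ.pathRe_of_segment_subset_path σ hq ⟨le_max_right _ _, hlt.le.trans hh.2⟩).2
  rw [hθ.pathRe_of_mem_Icc σ (Ioc_subset_Icc_self hl)] at hre
  rw [hθ.pathRe_of_mem_Icc σ ⟨le_max_left _ _, hlt.le.trans hl.2⟩] at hre'
  have hslope : edgeSlope θ (σ l) = edgeSlope θ (σ i) :=
    mul_right_cancel₀ (sub_pos.2 hlt).ne' (by linear_combination hre' - hre)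
  rwa [← σ.injective (hθ.strictMono_edgeSlope.injective hslope)]

theorem IsAdmissible.pathVertex_eq_of_segment_subset_path (hθ : IsAdmissible θ) {q : ℂ}
    {i : Fin n} (hq : segment ℝ q (q + edgeVec θ (σ i)) ⊆ path θ σ) : pathVertex θ σ i = q := by
  have hd := hθ.edgeDrop_pos (σ i)
  obtain ⟨htop, hbot⟩ :=
    (Ioc_subset_Ioc_iff (sub_lt_self _ hd)).1 (hθ.Ioc_subset_of_segment_subset_path σ hq)
  rw [level_succ] at hbot
  have him : level θ σ i = q.im := by linarith
  have hre := (hθ.pathRe_of_segment_subset_path σ hq (right_mem_Icc.2 (sub_le_self _ hd.le))).2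
  rw [← him, hθ.pathRe_of_mem_Icc σ (right_mem_Icc.2 (hθ.level_succ_lt σ i).le), sub_self,
    mul_zero, add_zero, add_zero] at hre
  exact Complex.ext hre him

end Path

/-! ### Exchanging a descent -/

section Exchange

variable {n : ℕ} {θ : Fin n → ℝ} {w : Equiv.Perm (Fin n)} {i j : Fin n}

/-- `w` has a descent at the adjacent positions `i` and `j`. -/
structure IsDescent (w : Equiv.Perm (Fin n)) (i j : Fin n) : Prop where
  val_add_one : (i : ℕ) + 1 = j
  lt : w j < w i

theorem IsDescent.index_lt (hd : IsDescent w i j) : i < j :=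
  Fin.lt_def.2 (Nat.lt_of_succ_le hd.val_add_one.le)

theorem IsDescent.mul_swap_lt (hd : IsDescent w i j) :
    toLex ⇑(w * Equiv.swap i j) < toLex ⇑w :=
  Pi.lex_desc hd.index_lt.le hd.lt

theorem exists_isDescent_of_ne_one (hw : w ≠ 1) : ∃ i j, IsDescent w i j := by
  contrapose! hw
  have hmono : StrictMono w := by
    obtain _ | n := n
    · exact Subsingleton.strictMono w
    · exact Fin.strictMono_iff_lt_succ.2 fun i =>
        (w.injective.ne i.castSucc_lt_succ.ne).lt_of_le (not_lt.1 fun h => hw _ _ ⟨rfl, h⟩)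
  exact Equiv.ext fun i => congrFun hmono.eq_id i

theorem descent_induction {P : Equiv.Perm (Fin n) → Prop} (one : P 1)
    (step : ∀ (w : Equiv.Perm (Fin n)) (i j : Fin n), IsDescent w i j →
      P (w * Equiv.swap i j) → P w) (w : Equiv.Perm (Fin n)) : P w := by
  induction h : toLex ⇑w using WellFoundedLT.induction generalizing w with
  | _ f ih =>
    subst h
    rcases eq_or_ne w 1 with rfl | hw
    · exact one
    · obtain ⟨i, j, hd⟩ := exists_isDescent_of_ne_one hw
      exact step w i j hd (ih _ hd.mul_swap_lt _ rfl)

theorem swap_apply_val_lt_iff {i j : Fin n} {k : ℕ} (h : (i : ℕ) < k ↔ (j : ℕ) < k) (l : Fin n) :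
    (Equiv.swap i j l : ℕ) < k ↔ (l : ℕ) < k := by
  rw [Equiv.swap_apply_def]
  split_ifs with hi hj
  · rw [hi, h]
  · rw [hj, h]
  · rfl

theorem pathVertex_mul_swap (w : Equiv.Perm (Fin n)) {k : ℕ} (h : (i : ℕ) < k ↔ (j : ℕ) < k) :
    pathVertex θ (w * Equiv.swap i j) k = pathVertex θ w k := by
  refine Finset.sum_equiv (Equiv.swap i j) (fun l => ?_) fun l _ => rfl
  simp only [Finset.mem_filter, Finset.mem_univ, true_and, swap_apply_val_lt_iff h]

theorem level_mul_swap (w : Equiv.Perm (Fin n)) {k : ℕ} (h : (i : ℕ) < k ↔ (j : ℕ) < k) :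
    level θ (w * Equiv.swap i j) k = level θ w k := by
  rw [level, pathVertex_mul_swap w h, level]

theorem pathEdge_mul_swap (hd : IsDescent w i j) {k : Fin n} (hi : k ≠ i) (hj : k ≠ j) :
    pathEdge θ (w * Equiv.swap i j) k = pathEdge θ w k := by
  have hij := hd.val_add_one
  rw [Ne, Fin.ext_iff] at hi hj
  rw [pathEdge, pathVertex_mul_swap w (by omega), pathVertex_mul_swap w (by omega), pathEdge]

/-- The rhombus that `X(w)` gains over `X(w * swap i j)` when `w` has a descent at `i` and `j`. -/
def descentTile (θ : Fin n → ℝ) (hd : IsDescent w i j) : Tile n :=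
  ⟨pathVertex θ w i, w j, w i, hd.lt⟩

theorem IsDescent.level_add_one (hd : IsDescent w i j) :
    level θ w (j + 1) = level θ w i - (edgeDrop θ (w j) + edgeDrop θ (w i)) := by
  rw [level_succ, ← hd.val_add_one, level_succ]
  ring

theorem bottom_descentTile (hd : IsDescent w i j) :
    (descentTile θ hd).bottom θ = level θ w (j + 1) := by
  rw [hd.level_add_one]
  rfl

theorem pathRe_sub_pathRe_mul_swap (hd : IsDescent w i j) (h : ℝ) :
    pathRe θ w h - pathRe θ (w * Equiv.swap i j) h =
      (descentTile θ hd).rightRe θ h - (descentTile θ hd).leftRe θ h := by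
  have hij := hd.val_add_one
  have hi : level θ (w * Equiv.swap i j) i = level θ w i := level_mul_swap w (by omega)
  have hj : level θ w j = level θ w i - edgeDrop θ (w i) := by rw [← hij, level_succ]
  have hj' : level θ (w * Equiv.swap i j) j = level θ w i - edgeDrop θ (w j) := by
    rw [← hij, level_succ, hi, Equiv.Perm.mul_apply, Equiv.swap_apply_left]
  unfold pathRe
  rw [← Finset.sum_sub_distrib, Finset.sum_eq_add i j hd.index_lt.ne]
  · rw [Equiv.Perm.mul_apply, Equiv.Perm.mul_apply, Equiv.swap_apply_left, Equiv.swap_apply_right,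
      hi, hj, hj', sub_right_comm, sub_right_comm _ _ h]
    simp only [Tile.rightRe, Tile.leftRe, bend, descentTile, level]
    ring
  · rintro l - ⟨hli, hlj⟩
    have hlevel : level θ (w * Equiv.swap i j) l = level θ w l :=
      level_mul_swap w (by rw [← Fin.lt_def, ← Fin.lt_def]; omega)
    rw [hlevel, Equiv.Perm.mul_apply, Equiv.swap_apply_of_ne_of_ne hli hlj, sub_self]
  · exact fun h => absurd (Finset.mem_univ i) h
  · exact fun h => absurd (Finset.mem_univ j) h

theorem IsAdmissible.pathRe_mul_swap_le (hθ : IsAdmissible θ) (hd : IsDescent w i j) (h : ℝ) :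
    pathRe θ (w * Equiv.swap i j) h ≤ pathRe θ w h := by
  rw [← sub_nonneg, pathRe_sub_pathRe_mul_swap hd, sub_nonneg]
  exact add_le_add_right (hθ.bend_le_bend hd.lt _) _

theorem IsAdmissible.pathRe_mul_swap_lt (hθ : IsAdmissible θ) (hd : IsDescent w i j) {h : ℝ}
    (hh : h ∈ Ioo (level θ w (j + 1)) (level θ w i)) :
    pathRe θ (w * Equiv.swap i j) h < pathRe θ w h := by
  rw [← bottom_descentTile hd] at hh
  rw [← sub_pos, pathRe_sub_pathRe_mul_swap hd, sub_pos]
  exact (descentTile θ hd).leftRe_lt_rightRe hθ hh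

theorem IsAdmissible.pathRe_mul_swap_eq (hθ : IsAdmissible θ) (hd : IsDescent w i j) {h : ℝ}
    (hh : h ∉ Ioo (level θ w (j + 1)) (level θ w i)) :
    pathRe θ (w * Equiv.swap i j) h = pathRe θ w h := by
  rw [eq_comm, ← sub_eq_zero, pathRe_sub_pathRe_mul_swap hd, sub_eq_zero]
  refine congrArg _ (hθ.bend_eq_bend _ _ fun hu => hh ?_).symm
  rw [hd.level_add_one]
  exact ⟨sub_lt_comm.1 hu.2, sub_pos.1 hu.1⟩

theorem IsAdmissible.rightRe_descentTile (hθ : IsAdmissible θ) (hd : IsDescent w i j) :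
    EqOn ((descentTile θ hd).rightRe θ) (pathRe θ w) (Icc (level θ w (j + 1)) (level θ w i)) := by
  intro h hh
  rcases le_total (level θ w j) h with hle | hle
  · have hmem : (⟨pathRe θ w h, h⟩ : ℂ) ∈ pathEdge θ w i :=
      (hθ.mem_pathEdge_iff w).2 ⟨⟨hd.val_add_one ▸ hle, hh.2⟩, rfl⟩
    rw [pathEdge_eq_segment] at hmem
    exact ((descentTile θ hd).mem_rightRe_of_mem_segment_hi hθ hmem).2.symm
  · have hmem : (⟨pathRe θ w h, h⟩ : ℂ) ∈ pathEdge θ w j :=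
      (hθ.mem_pathEdge_iff w).2 ⟨⟨hh.1, hle⟩, rfl⟩
    rw [pathEdge_eq_segment, ← hd.val_add_one, pathVertex_succ] at hmem
    exact ((descentTile θ hd).mem_rightRe_of_mem_segment_lo hθ hmem).2.symm

theorem IsAdmissible.leftRe_descentTile (hθ : IsAdmissible θ) (hd : IsDescent w i j) :
    EqOn ((descentTile θ hd).leftRe θ) (pathRe θ (w * Equiv.swap i j))
      (Icc (level θ w (j + 1)) (level θ w i)) := by
  intro h hh
  linear_combination hθ.rightRe_descentTile hd hh + pathRe_sub_pathRe_mul_swap (θ := θ) hd h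

theorem IsAdmissible.carrier_descentTile (hθ : IsAdmissible θ) (hd : IsDescent w i j) :
    (descentTile θ hd).carrier θ = region (level θ w (j + 1)) (level θ w i)
      (pathRe θ (w * Equiv.swap i j)) (pathRe θ w) := by
  rw [Tile.carrier_eq_region hθ, bottom_descentTile]
  exact region_congr (hθ.leftRe_descentTile hd) (hθ.rightRe_descentTile hd)

theorem IsAdmissible.pathRe_one_le (hθ : IsAdmissible θ) (w : Equiv.Perm (Fin n)) (h : ℝ) :
    pathRe θ 1 h ≤ pathRe θ w h := by
  induction w using descent_induction with
  | one => exact le_rfl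
  | step w i j hd ih => exact ih.trans (hθ.pathRe_mul_swap_le hd h)

variable [NeZero n]

theorem IsAdmissible.polygon_mul_swap_union (hθ : IsAdmissible θ) (hd : IsDescent w i j) :
    polygon θ (w * Equiv.swap i j) ∪ (descentTile θ hd).carrier θ = polygon θ w := by
  rw [hθ.polygon_eq_region, hθ.polygon_eq_region, hθ.carrier_descentTile]
  ext p
  constructor
  · rintro (⟨hp, hleft, hright⟩ | ⟨⟨hbot, htop⟩, hleft, hright⟩)
    · exact ⟨hp, hleft, hright.trans (hθ.pathRe_mul_swap_le hd _)⟩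
    · exact ⟨⟨(hθ.level_mem_Icc w j.2).1.trans hbot, htop.trans (hθ.level_mem_Icc w i.2.le).2⟩,
        (hθ.pathRe_one_le _ _).trans hleft, hright⟩
  · rintro ⟨hp, hleft, hright⟩
    rcases le_total p.re (pathRe θ (w * Equiv.swap i j) p.im) with hle | hle
    · exact Or.inl ⟨hp, hleft, hle⟩
    by_cases hh : p.im ∈ Ioo (level θ w (j + 1)) (level θ w i)
    · exact Or.inr ⟨Ioo_subset_Icc_self hh, hle, hright⟩
    · exact Or.inl ⟨hp, hleft, hright.trans_eq (hθ.pathRe_mul_swap_eq hd hh).symm⟩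

theorem IsAdmissible.disjoint_polygon_mul_swap (hθ : IsAdmissible θ) (hd : IsDescent w i j) :
    Disjoint (polygon θ (w * Equiv.swap i j)) (interior ((descentTile θ hd).carrier θ)) := by
  rw [hθ.polygon_eq_region, hθ.carrier_descentTile, disjoint_left]
  intro p hp hp'
  rw [mem_interior_region_iff (continuous_pathRe _) (continuous_pathRe _)] at hp'
  exact hp.2.2.not_gt hp'.2.1

end Exchange

/-! ### Tilings up to boundary points -/

section WeakTiling

variable {n : ℕ} {θ : Fin n → ℝ} {P : Set ℂ} {T : Finset (Tile n)} {t : Tile n}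

/-- The tiles in `T` do not overlap, lie in `P` and cover its interior. Unlike `IsRhombicTiling`,
this notion makes sense for the degenerate polygons `X(w)` that occur in inductions along descents,
whose two boundary paths may share edges. -/
structure IsWeakTiling (θ : Fin n → ℝ) (P : Set ℂ) (T : Finset (Tile n)) : Prop where
  pairwiseDisjoint : (T : Set (Tile n)).PairwiseDisjoint fun t => interior (t.carrier θ)
  carrier_subset : ∀ t ∈ T, t.carrier θ ⊆ P
  interior_subset : interior P ⊆ ⋃ t ∈ T, t.carrier θ

theorem IsRhombicTiling.isWeakTiling {w : Equiv.Perm (Fin n)} (hT : IsRhombicTiling θ w T) :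
    IsWeakTiling θ (polygon θ w) T where
  pairwiseDisjoint := hT.nonoverlapping
  carrier_subset _ ht := hT.covers ▸ subset_biUnion_of_mem ht
  interior_subset := hT.covers ▸ _root_.interior_subset

theorem IsWeakTiling.insert [DecidableEq (Tile n)] (hθ : IsAdmissible θ)
    (hT : IsWeakTiling θ P T) (ht : Disjoint P (interior (t.carrier θ))) :
    IsWeakTiling θ (P ∪ t.carrier θ) (insert t T) where
  pairwiseDisjoint := by
    rw [Finset.coe_insert]
    exact hT.pairwiseDisjoint.insert fun s hs _ =>
      (ht.mono_left (_root_.interior_subset.trans (hT.carrier_subset s hs))).symm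
  carrier_subset := Finset.forall_mem_insert _ _ _ |>.2
    ⟨subset_union_right, fun s hs => (hT.carrier_subset s hs).trans subset_union_left⟩
  interior_subset := by
    rw [Finset.set_biUnion_insert, union_comm (t.carrier θ)]
    exact (t.isClosed_carrier hθ).interior_union_right.trans
      (union_subset_union_left _ hT.interior_subset)

theorem IsWeakTiling.erase [DecidableEq (Tile n)] (hθ : IsAdmissible θ) (hP : IsClosed P)
    (hT : IsWeakTiling θ (P ∪ t.carrier θ) T) (ht : Disjoint P (interior (t.carrier θ)))
    (htT : t ∈ T) : IsWeakTiling θ P (T.erase t) where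
  pairwiseDisjoint := hT.pairwiseDisjoint.subset (Finset.coe_subset.2 (Finset.erase_subset t T))
  carrier_subset s hs := by
    obtain ⟨hne, hs⟩ := Finset.mem_erase.1 hs
    have hdisj : Disjoint (interior (s.carrier θ)) (interior (t.carrier θ)) :=
      hT.pairwiseDisjoint hs htT hne
    have hsub : interior (s.carrier θ) ⊆ P :=
      hdisj.subset_left_of_subset_union
        ((interior_mono (hT.carrier_subset s hs)).trans hP.interior_union_left)
    exact (s.carrier_subset_closure_interior hθ).trans (closure_minimal hsub hP)
  interior_subset p hp := by
    obtain ⟨s, hs, hps⟩ := mem_iUnion₂.1 (hT.interior_subset (interior_mono subset_union_left hp))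
    refine mem_biUnion (Finset.mem_coe.2 (Finset.mem_erase.2 ⟨?_, hs⟩)) hps
    rintro rfl
    obtain ⟨q, hqP, hqs⟩ := mem_closure_iff.1 (s.carrier_subset_closure_interior hθ hps) _
      isOpen_interior hp
    exact disjoint_left.1 ht (_root_.interior_subset hqP) hqs

theorem IsAdmissible.isWeakTiling_polygon_one [NeZero n] (hθ : IsAdmissible θ) :
    IsWeakTiling θ (polygon θ 1) ∅ where
  pairwiseDisjoint := by simp only [Finset.coe_empty, pairwiseDisjoint_empty]
  carrier_subset := by simp only [Finset.notMem_empty, false_imp_iff, implies_true]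
  interior_subset p hp := by
    rw [hθ.polygon_eq_region,
      mem_interior_region_iff (continuous_pathRe _) (continuous_pathRe _)] at hp
    exact absurd (hp.2.1.trans hp.2.2) (lt_irrefl _)

theorem IsAdmissible.exists_isWeakTiling [NeZero n] (hθ : IsAdmissible θ)
    (w : Equiv.Perm (Fin n)) : ∃ T, IsWeakTiling θ (polygon θ w) T := by
  classical
  induction w using descent_induction with
  | one => exact ⟨∅, hθ.isWeakTiling_polygon_one⟩
  | step w i j hd ih =>
    obtain ⟨T, hT⟩ := ih
    rw [← hθ.polygon_mul_swap_union hd]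
    exact ⟨_, hT.insert hθ (hθ.disjoint_polygon_mul_swap hd)⟩

theorem IsWeakTiling.isRhombicTiling {w : Equiv.Perm (Fin n)} (hθ : IsAdmissible θ)
    (hT : IsWeakTiling θ (polygon θ w) T)
    (hw : polygon θ w ⊆ closure (interior (polygon θ w))) : IsRhombicTiling θ w T where
  nonoverlapping := hT.pairwiseDisjoint
  covers := (iUnion₂_subset hT.carrier_subset).antisymm <| hw.trans <|
    closure_minimal hT.interior_subset (T.finite_toSet.isClosed_biUnion fun t _ =>
      t.isClosed_carrier hθ)

theorem IsWeakTiling.erase_descentTile [DecidableEq (Tile n)] [NeZero n] (hθ : IsAdmissible θ)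
    {w : Equiv.Perm (Fin n)} {i j : Fin n} (hd : IsDescent w i j)
    (hT : IsWeakTiling θ (polygon θ w) T) (ht : descentTile θ hd ∈ T) :
    IsWeakTiling θ (polygon θ (w * Equiv.swap i j)) (T.erase (descentTile θ hd)) := by
  rw [← hθ.polygon_mul_swap_union hd] at hT
  exact hT.erase hθ (hθ.isClosed_polygon _) (hθ.disjoint_polygon_mul_swap hd) ht

end WeakTiling

section FullySupported

variable {n : ℕ} {θ : Fin n → ℝ} {w : Equiv.Perm (Fin n)}

/- Along descents the right boundary only moves to the left, and the exchange at `i`, `j` leaves it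
fixed at height `h` only if both positions lie on the same side of `k`. -/
theorem IsAdmissible.apply_val_lt_iff_of_pathRe_eq (hθ : IsAdmissible θ) {k : Fin n} {h : ℝ}
    (hh : h ∈ Ioo (level θ w (k + 1)) (level θ w k)) (heq : pathRe θ 1 h = pathRe θ w h) {r : ℕ}
    (hr : r ∈ Icc (k : ℕ) (k + 1)) (l : Fin n) : (w l : ℕ) < r ↔ (l : ℕ) < r := by
  induction w using descent_induction generalizing l with
  | one => rfl
  | step w i j hd ih =>
    have hanti := (hθ.strictAntiOn_level w).antitoneOn
    have hij := hd.val_add_one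
    have hhd : h ∉ Ioo (level θ w (j + 1)) (level θ w i) := fun hhd =>
      (hθ.pathRe_one_le _ h).not_gt (heq ▸ hθ.pathRe_mul_swap_lt hd hhd)
    have hk : (k : ℕ) < i ∨ (j : ℕ) < k := by
      by_contra! hk
      exact hhd ⟨(hanti k.2 j.2 (by omega)).trans_lt hh.1, hh.2.trans_le (hanti i.2.le k.2.le hk.1)⟩
    have hswap := ih (by rwa [level_mul_swap w (by omega), level_mul_swap w (by omega)])
      (by rw [heq, hθ.pathRe_mul_swap_eq hd hhd]) (Equiv.swap i j l)
    rw [Equiv.Perm.mul_apply, Equiv.swap_apply_self] at hswap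
    exact hswap.trans (swap_apply_val_lt_iff (by rw [mem_Icc] at hr; omega) l)

theorem FullySupported.pathRe_one_lt (hw : FullySupported w) (hn : 1 < n) (hθ : IsAdmissible θ)
    {k : Fin n} {h : ℝ} (hh : h ∈ Ioo (level θ w (k + 1)) (level θ w k)) :
    pathRe θ 1 h < pathRe θ w h := by
  refine (hθ.pathRe_one_le w h).lt_of_ne fun heq => ?_
  obtain ⟨r, hr, h0, hrn⟩ : ∃ r ∈ Icc (k : ℕ) (k + 1), 0 < r ∧ r < n := by
    rcases Nat.eq_zero_or_pos k with hk | hk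
    · exact ⟨1, by rw [hk]; simp, one_pos, hn⟩
    · exact ⟨k, left_mem_Icc.2 (Nat.le_succ k), hk, k.2⟩
  exact hw r h0 hrn <| (w.eq_preimage_iff_image_eq _ _).1 <| ext fun l =>
    (hθ.apply_val_lt_iff_of_pathRe_eq hh heq hr l).symm

theorem FullySupported.polygon_subset_closure_interior (hw : FullySupported w) (hn : 1 < n)
    (hθ : IsAdmissible θ) : polygon θ w ⊆ closure (interior (polygon θ w)) := by
  have : NeZero n := ⟨by omega⟩
  have hlevel : (range fun k : Fin n => level θ w k).Finite := finite_range _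
  have hbot : pathBottom θ < 0 := by
    rw [← level_length w, ← level_zero (θ := θ) w]
    exact hθ.strictAntiOn_level w (Nat.zero_le n) self_mem_Iic (by omega)
  rw [hθ.polygon_eq_region]
  refine region_subset_closure_interior (continuous_pathRe _) (continuous_pathRe _) ?_
  rw [← closure_Ioo hbot.ne]
  refine closure_minimal (((hlevel.countable.dense_compl ℝ).open_subset_closure_inter
    isOpen_Ioo).trans (closure_mono ?_)) isClosed_closure
  rintro h ⟨hh, hne⟩
  obtain ⟨k, hk⟩ := exists_mem_Ioc_level w (Ioo_subset_Ioc_self hh)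
  exact ⟨hh, hw.pathRe_one_lt hn hθ ⟨hk.1, hk.2.lt_of_ne fun h => hne ⟨k, h.symm⟩⟩⟩

end FullySupported

/-! ### The rightmost tile -/

theorem re_lt_of_disjoint {s t : Set ℂ} (hs : Convex ℝ s) (hso : IsOpen s) (ht : Convex ℝ t)
    (hto : IsOpen t) (hst : Disjoint s t) {p p' q q' : ℂ} (hp : p ∈ s) (hp' : p' ∈ s)
    (hq : q ∈ t) (hq' : q' ∈ t) (him' : p'.im = q'.im) (hre' : p'.re < q'.re)
    (him : p.im = q.im) : p.re < q.re := by
  obtain ⟨f, u, hfs, hft⟩ := geometric_hahn_banach_open_open hs hso ht hto hst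
  have hf : ∀ {a b : ℂ}, a ∈ s → b ∈ t → a.im = b.im → 0 < (b.re - a.re) * f 1 := by
    intro a b ha hb hab
    have hsub : b - a = (b.re - a.re) • (1 : ℂ) := by
      apply Complex.ext <;> simp [hab]
    rw [← smul_eq_mul, ← map_smul, ← hsub, map_sub, sub_pos]
    exact (hfs a ha).trans (hft b hb)
  have hone : 0 < f 1 := (mul_pos_iff_of_pos_left (sub_pos.2 hre')).1 (hf hp' hq' him')
  exact sub_pos.1 ((mul_pos_iff_of_pos_right hone).1 (hf hp hq him))

section Rightmost

variable {n : ℕ} {θ : Fin n → ℝ} {s t u : Tile n}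

/-- Some horizontal line meets the interior of `s` to the left of a point in the interior of `t`.
For tiles that do not overlap, `s` is then to the left of `t` on every horizontal line that meets
both interiors. -/
def Tile.LeftOf (θ : Fin n → ℝ) (s t : Tile n) : Prop :=
  ∃ p ∈ interior (s.carrier θ), ∃ q ∈ interior (t.carrier θ), p.im = q.im ∧ p.re < q.re

theorem Tile.LeftOf.re_lt (h : s.LeftOf θ t)
    (hst : Disjoint (interior (s.carrier θ)) (interior (t.carrier θ))) {p q : ℂ}
    (hp : p ∈ interior (s.carrier θ)) (hq : q ∈ interior (t.carrier θ)) (him : p.im = q.im) :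
    p.re < q.re := by
  obtain ⟨p', hp', q', hq', him', hre'⟩ := h
  exact re_lt_of_disjoint s.convex_carrier.interior isOpen_interior t.convex_carrier.interior
    isOpen_interior hst hp hp' hq hq' him' hre' him

theorem Tile.LeftOf.asymm (h : s.LeftOf θ t)
    (hst : Disjoint (interior (s.carrier θ)) (interior (t.carrier θ))) : ¬ t.LeftOf θ s :=
  fun ⟨_, hq, _, hp, him, hre⟩ => (h.re_lt hst hp hq him.symm).not_gt hre

/- `LeftOf` is not transitive in general. If the middle tile has the lowest top, then a horizontal
line just below that top meets all three tiles. -/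
theorem Tile.LeftOf.trans (hθ : IsAdmissible θ) (h : s.LeftOf θ t) (h' : t.LeftOf θ u)
    (hst : Disjoint (interior (s.carrier θ)) (interior (t.carrier θ)))
    (htu : Disjoint (interior (t.carrier θ)) (interior (u.carrier θ)))
    (hts : t.top.im ≤ s.top.im) (htu' : t.top.im ≤ u.top.im) : s.LeftOf θ u := by
  obtain ⟨p, hp, q, hq, hpq, -⟩ := id h
  obtain ⟨q', hq', r, hr, hqr, -⟩ := id h'
  rw [Tile.mem_interior_carrier_iff hθ] at hp hq hq' hr
  set y := max p.im r.im
  have hyt : y < t.top.im := max_lt (hpq ▸ hq.1.2) (hqr ▸ hq'.1.2)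
  obtain ⟨a, ha, hay⟩ := s.exists_mem_interior_carrier hθ (h := y)
    ⟨hp.1.1.trans_le (le_max_left _ _), hyt.trans_le hts⟩
  obtain ⟨b, hb, hby⟩ := t.exists_mem_interior_carrier hθ (h := y)
    ⟨(hpq ▸ hq.1.1).trans_le (le_max_left _ _), hyt⟩
  obtain ⟨c, hc, hcy⟩ := u.exists_mem_interior_carrier hθ (h := y)
    ⟨hr.1.1.trans_le (le_max_right _ _), hyt.trans_le htu'⟩
  exact ⟨a, ha, c, hc, hay.trans hcy.symm,
    (h.re_lt hst ha hb (hay.trans hby.symm)).trans (h'.re_lt htu hb hc (hby.trans hcy.symm))⟩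

theorem exists_rightmost (hθ : IsAdmissible θ) {T : Finset (Tile n)}
    (hT : (T : Set (Tile n)).PairwiseDisjoint fun t => interior (t.carrier θ))
    (hne : T.Nonempty) : ∃ t ∈ T, ∀ s ∈ T, s ≠ t → ¬ t.LeftOf θ s := by
  classical
  induction T using Finset.induction_on_min_value (fun t : Tile n => t.top.im) with
  | empty => exact absurd hne Finset.not_nonempty_empty
  | insert a T haT hmin ih =>
    rcases T.eq_empty_or_nonempty with rfl | hTne
    · exact ⟨a, Finset.mem_insert_self _ _, fun s hs hsa => absurd hs (by simp [hsa])⟩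
    obtain ⟨m, hm, hmax⟩ :=
      ih (hT.subset (Finset.coe_subset.2 (Finset.subset_insert a T))) hTne
    have hma : Disjoint (interior (m.carrier θ)) (interior (a.carrier θ)) :=
      hT (Finset.mem_insert_of_mem hm) (Finset.mem_insert_self _ _) (ne_of_mem_of_not_mem hm haT)
    by_cases hlt : m.LeftOf θ a
    · refine ⟨a, Finset.mem_insert_self _ _, fun u hu hua hau => ?_⟩
      have hu : u ∈ T := (Finset.mem_insert.1 hu).resolve_left hua
      have hau' : Disjoint (interior (a.carrier θ)) (interior (u.carrier θ)) :=
        hT (Finset.mem_insert_self _ _) (Finset.mem_insert_of_mem hu) hua.symm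
      refine hmax u hu ?_ (hlt.trans hθ hau hma hau' (hmin m hm) (hmin u hu))
      rintro rfl
      exact hlt.asymm hma hau
    · refine ⟨m, Finset.mem_insert_of_mem hm, fun s hs hsm => ?_⟩
      rcases Finset.mem_insert.1 hs with rfl | hs
      · exact hlt
      · exact hmax s hs hsm

variable [NeZero n] {w : Equiv.Perm (Fin n)} {T : Finset (Tile n)}

theorem Tile.rightRe_mem_of_carrier_subset_polygon (hθ : IsAdmissible θ)
    (ht : t.carrier θ ⊆ polygon θ w) {h : ℝ} (hh : h ∈ Icc (t.bottom θ) t.top.im) :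
    h ∈ Icc (pathBottom θ) 0 ∧ t.rightRe θ h ∈ Icc (pathRe θ 1 h) (pathRe θ w h) := by
  rw [t.carrier_eq_region hθ, hθ.polygon_eq_region] at ht
  refine ht (a := ⟨t.rightRe θ h, h⟩) ⟨hh, ?_, le_rfl⟩
  exact add_le_add_right (hθ.bend_le_bend t.lo_lt_hi _) _

theorem IsWeakTiling.rightRe_eq_pathRe (hθ : IsAdmissible θ)
    (hT : IsWeakTiling θ (polygon θ w) T) (ht : t ∈ T)
    (hmax : ∀ s ∈ T, s ≠ t → ¬ t.LeftOf θ s) :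
    EqOn (t.rightRe θ) (pathRe θ w) (Icc (t.bottom θ) t.top.im) := by
  have hbt := t.bottom_lt_top hθ
  have hsub := hT.carrier_subset t ht
  have hright := t.continuous_rightRe (θ := θ)
  rw [← closure_Ioo hbt.ne]
  refine EqOn.closure (fun h hh => ?_) hright (continuous_pathRe w)
  obtain ⟨-, hle1, hle⟩ :=
    t.rightRe_mem_of_carrier_subset_polygon hθ hsub (Ioo_subset_Icc_self hh)
  refine hle.antisymm (not_lt.1 fun hlt => ?_)
  obtain ⟨x, hx, hx'⟩ := exists_between hlt
  have hbot := (t.rightRe_mem_of_carrier_subset_polygon hθ hsub (left_mem_Icc.2 hbt.le)).1.1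
  have htop := (t.rightRe_mem_of_carrier_subset_polygon hθ hsub (right_mem_Icc.2 hbt.le)).1.2
  have hint : (⟨x, h⟩ : ℂ) ∈ interior (polygon θ w) := by
    rw [hθ.polygon_eq_region,
      mem_interior_region_iff (continuous_pathRe _) (continuous_pathRe _)]
    exact ⟨⟨hbot.trans_lt hh.1, hh.2.trans_le htop⟩, hle1.trans_lt hx, hx'⟩
  obtain ⟨s, hs, hxs⟩ := mem_iUnion₂.1 (hT.interior_subset hint)
  have hopen : IsOpen {q : ℂ | q.im ∈ Ioo (t.bottom θ) t.top.im ∧ t.rightRe θ q.im < q.re} :=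
    (isOpen_Ioo.preimage Complex.continuous_im).inter
      (isOpen_lt (hright.comp Complex.continuous_im) Complex.continuous_re)
  obtain ⟨q, ⟨hqh, hqt⟩, hqs⟩ := mem_closure_iff.1 (s.carrier_subset_closure_interior hθ hxs) _
    hopen ⟨hh, hx⟩
  obtain ⟨p, hp, hpq⟩ := t.exists_mem_interior_carrier hθ hqh
  refine hmax s hs ?_ ⟨p, hp, q, hqs, hpq, ?_⟩
  · rintro rfl
    exact hqt.not_gt ((s.mem_interior_carrier_iff hθ).1 hqs).2.2
  · exact (((t.mem_interior_carrier_iff hθ).1 hp).2.2).trans (hpq ▸ hqt)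

/- The right side of a rightmost tile is part of the right boundary, so its two edges are path edges
and form a descent. -/
theorem IsWeakTiling.exists_descentTile_mem (hθ : IsAdmissible θ)
    (hT : IsWeakTiling θ (polygon θ w) T) (hne : T.Nonempty) :
    ∃ i j, ∃ hd : IsDescent w i j, descentTile θ hd ∈ T := by
  obtain ⟨t, ht, hmax⟩ := exists_rightmost hθ hT.pairwiseDisjoint hne
  have hpath : ∀ {p : ℂ}, p.im ∈ Icc (t.bottom θ) t.top.im ∧ p.re = t.rightRe θ p.im →
      p ∈ path θ w := fun ⟨him, hre⟩ => (hθ.mem_path_iff w).2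
    ⟨(t.rightRe_mem_of_carrier_subset_polygon hθ (hT.carrier_subset t ht) him).1,
      hre.trans (hT.rightRe_eq_pathRe hθ ht hmax him)⟩
  obtain ⟨i, hi⟩ := w.surjective t.hi
  obtain ⟨j, hj⟩ := w.surjective t.lo
  have htop : pathVertex θ w i = t.top := hθ.pathVertex_eq_of_segment_subset_path w <| by
    rw [hi]
    exact fun p hp => hpath (t.mem_rightRe_of_mem_segment_hi hθ hp)
  have hmid : pathVertex θ w j = t.top + edgeVec θ t.hi :=
    hθ.pathVertex_eq_of_segment_subset_path w <| by
      rw [hj]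
      exact fun p hp => hpath (t.mem_rightRe_of_mem_segment_lo hθ hp)
  have hval : (i : ℕ) + 1 = j := by
    refine (hθ.strictAntiOn_level w).injOn i.2 j.2.le ?_
    rw [level, level, pathVertex_succ, htop, hi, hmid]
  refine ⟨i, j, ⟨hval, by rw [hi, hj]; exact t.lo_lt_hi⟩, ?_⟩
  convert ht
  cases t
  simp only [descentTile, htop, hi, hj]

end Rightmost

/-! ### Left-to-right maxima, right-to-left minima and exchanges -/

section Extremal

variable {n : ℕ} {w : Equiv.Perm (Fin n)} {i j k x y : Fin n}

theorem isLRMax_apply_iff : IsLRMax w (w k) ↔ ∀ l < k, w l < w k := by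
  refine ⟨?_, fun h => ⟨k, rfl, h⟩⟩
  rintro ⟨i, hi, h⟩
  rwa [w.injective hi] at h

theorem isRLMin_apply_iff : IsRLMin w (w k) ↔ ∀ l, k < l → w k < w l := by
  refine ⟨?_, fun h => ⟨k, rfl, h⟩⟩
  rintro ⟨i, hi, h⟩
  rwa [w.injective hi] at h

theorem lt_or_eq_of_swap_lt_swap (hij : (i : ℕ) + 1 = j) {l m : Fin n}
    (h : Equiv.swap i j l < Equiv.swap i j m) : l < m ∨ l = j ∧ m = i := by
  simp only [Equiv.swap_apply_def] at h
  split_ifs at h <;> omega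

theorem IsDescent.isLRMax_mul_swap (hd : IsDescent w i j) (hx : IsLRMax w x) :
    IsLRMax (w * Equiv.swap i j) x := by
  obtain ⟨k, rfl, hmax⟩ := hx
  refine ⟨Equiv.swap i j k, by simp, fun l hl => ?_⟩
  rw [← Equiv.swap_apply_self i j l] at hl
  rcases lt_or_eq_of_swap_lt_swap hd.val_add_one hl with hlk | ⟨hlj, rfl⟩
  · exact hmax _ hlk
  · rw [Equiv.Perm.mul_apply, hlj]
    exact hd.lt

theorem IsDescent.isRLMin_mul_swap (hd : IsDescent w i j) (hy : IsRLMin w y) :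
    IsRLMin (w * Equiv.swap i j) y := by
  obtain ⟨k, rfl, hmin⟩ := hy
  refine ⟨Equiv.swap i j k, by simp, fun l hl => ?_⟩
  rw [← Equiv.swap_apply_self i j l] at hl
  rcases lt_or_eq_of_swap_lt_swap hd.val_add_one hl with hkl | ⟨rfl, hli⟩
  · exact hmin _ hkl
  · rw [Equiv.Perm.mul_apply, hli]
    exact hd.lt

theorem IsDescent.not_isLRMax (hd : IsDescent w i j) : ¬ IsLRMax w (w j) := fun h =>
  (isLRMax_apply_iff.1 h i hd.index_lt).not_gt hd.lt

theorem IsDescent.not_isRLMin (hd : IsDescent w i j) : ¬ IsRLMin w (w i) := fun h =>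
  (isRLMin_apply_iff.1 h j hd.index_lt).not_gt hd.lt

theorem not_togetherIn321_iff (hd : IsDescent w i j) :
    ¬ TogetherIn321 w (w i) (w j) ↔ IsLRMax w (w i) ∧ IsRLMin w (w j) := by
  have hij := hd.val_add_one
  constructor
  · refine fun h => ⟨isLRMax_apply_iff.2 fun l hl => ?_, isRLMin_apply_iff.2 fun l hl => ?_⟩
    · refine (w.injective.ne hl.ne).lt_of_le (not_lt.1 fun hlt => h ?_)
      exact ⟨l, i, j, hl, hd.index_lt, hd.lt, hlt, by simp, by simp⟩
    · refine (w.injective.ne hl.ne).lt_of_le (not_lt.1 fun hlt => h ?_)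
      exact ⟨i, j, l, hd.index_lt, hl, hlt, hd.lt, by simp, by simp⟩
  · rintro ⟨hmax, hmin⟩ ⟨a, b, c, hab, hbc, hcb, hba, hia, hja⟩
    rw [isLRMax_apply_iff] at hmax
    rw [isRLMin_apply_iff] at hmin
    simp only [mem_insert_iff, mem_singleton_iff, EmbeddingLike.apply_eq_iff_eq] at hia hja
    have hi : i = a := by
      rcases hia with rfl | rfl | rfl
      · rfl
      · exact absurd hba (hmax a hab).not_gt
      · exact absurd hcb (hmax b hbc).not_gt
    have hj : j = c := by
      rcases hja with rfl | rfl | rfl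
      · exact absurd hba (hmin b hab).not_gt
      · exact absurd hcb (hmin c hbc).not_gt
      · rfl
    subst hi hj
    omega

end Extremal

/-! ### Forced and avoidable tiles -/

section Forced

variable {n : ℕ} {θ : Fin n → ℝ} {w : Equiv.Perm (Fin n)} {i j k : Fin n} {T : Finset (Tile n)}
  {t : Tile n}

theorem exists_descentTile_mul_swap_eq {a b : Fin n} (hab : IsDescent w a b)
    (hd : IsDescent w i j) (hia : i ≠ a) (hib : i ≠ b) (hja : j ≠ a) (hjb : j ≠ b) :
    ∃ hd' : IsDescent (w * Equiv.swap a b) i j, descentTile θ hd' = descentTile θ hd := by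
  have hi : (w * Equiv.swap a b) i = w i :=
    congrArg w (Equiv.swap_apply_of_ne_of_ne hia hib)
  have hj : (w * Equiv.swap a b) j = w j :=
    congrArg w (Equiv.swap_apply_of_ne_of_ne hja hjb)
  refine ⟨⟨hd.val_add_one, by rw [hi, hj]; exact hd.lt⟩, ?_⟩
  have hval := hab.val_add_one
  simp only [descentTile, hi, hj, pathVertex_mul_swap (θ := θ) w (k := i) (i := a) (j := b)
    (by omega)]

variable [NeZero n]

theorem IsWeakTiling.nonempty_of_isDescent (hθ : IsAdmissible θ)
    (hT : IsWeakTiling θ (polygon θ w) T) (hd : IsDescent w i j) : T.Nonempty := by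
  obtain ⟨h, hh⟩ := exists_between ((descentTile θ hd).bottom_lt_top hθ)
  obtain ⟨p, hp, -⟩ := (descentTile θ hd).exists_mem_interior_carrier hθ hh
  have hsub : (descentTile θ hd).carrier θ ⊆ polygon θ w :=
    hθ.polygon_mul_swap_union hd ▸ subset_union_right
  obtain ⟨t, ht, -⟩ := mem_iUnion₂.1 (hT.interior_subset (interior_mono hsub hp))
  exact ⟨t, ht⟩

/- Any other descent of `w` is disjoint from the descent at `i`, `j`, so removing its tile keeps all
hypotheses. -/
theorem IsWeakTiling.descentTile_mem (hθ : IsAdmissible θ) (hT : IsWeakTiling θ (polygon θ w) T)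
    (hd : IsDescent w i j) (hmax : IsLRMax w (w i)) (hmin : IsRLMin w (w j)) :
    descentTile θ hd ∈ T := by
  classical
  induction T using Finset.strongInduction generalizing w with
  | H T ih =>
    obtain ⟨a, b, hab, hmem⟩ :=
      hT.exists_descentTile_mem hθ (hT.nonempty_of_isDescent hθ hd)
    have hij := hd.val_add_one
    have hval := hab.val_add_one
    have hib : i ≠ b := fun h => hab.not_isLRMax (h ▸ hmax)
    have hja : j ≠ a := fun h => hab.not_isRLMin (h ▸ hmin)
    rcases eq_or_ne i a with rfl | hia
    · obtain rfl : j = b := Fin.ext (hij.symm.trans hval)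
      exact hmem
    obtain ⟨hd', htile⟩ :=
      exists_descentTile_mul_swap_eq (θ := θ) hab hd hia hib hja (by omega)
    have hmax' : IsLRMax (w * Equiv.swap a b) ((w * Equiv.swap a b) i) := by
      rw [Equiv.Perm.mul_apply, Equiv.swap_apply_of_ne_of_ne hia hib]
      exact hab.isLRMax_mul_swap hmax
    have hmin' : IsRLMin (w * Equiv.swap a b) ((w * Equiv.swap a b) j) := by
      rw [Equiv.Perm.mul_apply, Equiv.swap_apply_of_ne_of_ne hja (by omega)]
      exact hab.isRLMin_mul_swap hmin
    rw [← htile]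
    exact Finset.mem_of_mem_erase
      (ih _ (Finset.erase_ssubset hmem) (hT.erase_descentTile hθ hab hmem) hd' hmax' hmin')

/-- Some tiling of `X(w)`, up to boundary points, does not contain the tile `t`. -/
def Tile.IsAvoidable (θ : Fin n → ℝ) (w : Equiv.Perm (Fin n)) (t : Tile n) : Prop :=
  ∃ T, IsWeakTiling θ (polygon θ w) T ∧ t ∉ T

theorem Tile.isAvoidable_of_not_subset (hθ : IsAdmissible θ)
    (ht : ¬ t.carrier θ ⊆ polygon θ w) : t.IsAvoidable θ w := by
  obtain ⟨T, hT⟩ := hθ.exists_isWeakTiling w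
  exact ⟨T, hT, fun hmem => ht (hT.carrier_subset t hmem)⟩

theorem Tile.IsAvoidable.of_mul_swap (hθ : IsAdmissible θ) (hd : IsDescent w i j)
    (h : t.IsAvoidable θ (w * Equiv.swap i j)) (ht : t ≠ descentTile θ hd) :
    t.IsAvoidable θ w := by
  classical
  obtain ⟨T, hT, htT⟩ := h
  refine ⟨insert (descentTile θ hd) T, ?_, ?_⟩
  · rw [← hθ.polygon_mul_swap_union hd]
    exact hT.insert hθ (hθ.disjoint_polygon_mul_swap hd)
  · exact Finset.mem_insert.not.2 (not_or.2 ⟨ht, htT⟩)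

theorem IsAdmissible.not_pathEdge_subset_polygon_mul_swap (hθ : IsAdmissible θ)
    (hd : IsDescent w i j) (hk : k = i ∨ k = j) :
    ¬ pathEdge θ w k ⊆ polygon θ (w * Equiv.swap i j) := by
  intro hsub
  have hij := hd.val_add_one
  have hanti := (hθ.strictAntiOn_level w).antitoneOn
  obtain ⟨h, hbot, htop⟩ := exists_between (hθ.level_succ_lt w k)
  have hmem : (⟨pathRe θ w h, h⟩ : ℂ) ∈ polygon θ (w * Equiv.swap i j) :=
    hsub ((hθ.mem_pathEdge_iff w).2 ⟨⟨hbot.le, htop.le⟩, rfl⟩)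
  rw [hθ.polygon_eq_region] at hmem
  refine hmem.2.2.not_gt (hθ.pathRe_mul_swap_lt hd ⟨?_, ?_⟩)
  · exact (hanti k.2 j.2 (by omega)).trans_lt hbot
  · exact htop.trans_le (hanti i.2.le k.2.le (by omega))

theorem IsDescent.isAvoidable (hθ : IsAdmissible θ) (hd : IsDescent w i j)
    (hk : k = i ∨ k = j) (hedge : pathEdge θ w k ⊆ t.carrier θ) (ht : t ≠ descentTile θ hd) :
    t.IsAvoidable θ w :=
  .of_mul_swap hθ hd (t.isAvoidable_of_not_subset hθ fun h =>
    hθ.not_pathEdge_subset_polygon_mul_swap hd hk (hedge.trans h)) ht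

/- Exchanges move the larger label at `a` down until it is next to position `k`. The exchange there
has a tile whose larger label is not `w k` and cuts off the edge at `k`. -/
theorem Tile.isAvoidable_of_lt_apply (hθ : IsAdmissible θ) {a : Fin n} (hak : a < k)
    (hwa : w k < w a) (hhi : t.hi = w k) (hedge : pathEdge θ w k ⊆ t.carrier θ) :
    t.IsAvoidable θ w := by
  induction hm : (k : ℕ) - a generalizing a w with
  | zero => omega
  | succ m ih =>
    have hne : ∀ {b} (hd : IsDescent w a b), t ≠ descentTile θ hd := fun hd h =>
      hwa.ne' ((congrArg Tile.hi h).symm.trans hhi)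
    obtain ⟨b, hab⟩ : ∃ b : Fin n, (a : ℕ) + 1 = b := ⟨⟨a + 1, by omega⟩, rfl⟩
    rcases eq_or_ne k b with rfl | hkb
    · exact IsDescent.isAvoidable hθ ⟨hab, hwa⟩ (Or.inr rfl) hedge (hne _)
    rcases lt_or_ge (w k) (w b) with hwb | hwb
    · exact ih (by omega) hwb hhi hedge (by omega)
    have hd : IsDescent w a b := ⟨hab, hwb.trans_lt hwa⟩
    have hk : (w * Equiv.swap a b) k = w k :=
      congrArg w (Equiv.swap_apply_of_ne_of_ne hak.ne' hkb)
    have hb : (w * Equiv.swap a b) b = w a := congrArg w (Equiv.swap_apply_right a b)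
    refine .of_mul_swap hθ hd ?_ (hne hd)
    exact ih (a := b) (by omega) (by rwa [hk, hb]) (by rw [hhi, hk])
      (by rwa [pathEdge_mul_swap hd hak.ne' hkb]) (by omega)

theorem Tile.isAvoidable_of_apply_lt (hθ : IsAdmissible θ) {c : Fin n} (hkc : k < c)
    (hwc : w c < w k) (hlo : t.lo = w k) (hedge : pathEdge θ w k ⊆ t.carrier θ) :
    t.IsAvoidable θ w := by
  induction hm : (c : ℕ) - k generalizing c w with
  | zero => omega
  | succ m ih =>
    have hne : ∀ {b} (hd : IsDescent w b c), t ≠ descentTile θ hd := fun hd h =>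
      hwc.ne ((congrArg Tile.lo h).symm.trans hlo)
    obtain ⟨b, hbc⟩ : ∃ b : Fin n, (b : ℕ) + 1 = c :=
      ⟨⟨c - 1, by omega⟩, Nat.sub_add_cancel (by omega)⟩
    rcases eq_or_ne k b with rfl | hkb
    · exact IsDescent.isAvoidable hθ ⟨hbc, hwc⟩ (Or.inl rfl) hedge (hne _)
    rcases lt_or_ge (w b) (w k) with hwb | hwb
    · exact ih (by omega) hwb hlo hedge (by omega)
    have hd : IsDescent w b c := ⟨hbc, hwc.trans_le hwb⟩
    have hk : (w * Equiv.swap b c) k = w k :=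
      congrArg w (Equiv.swap_apply_of_ne_of_ne hkb hkc.ne)
    have hb : (w * Equiv.swap b c) b = w c := congrArg w (Equiv.swap_apply_left b c)
    refine .of_mul_swap hθ hd ?_ (hne hd)
    exact ih (c := b) (by omega) (by rwa [hk, hb]) (by rw [hlo, hk])
      (by rwa [pathEdge_mul_swap hd hkb hkc.ne]) (by omega)

end Forced

/-! ### Right-perimeter tiles -/

section RightPerimeter

variable {n : ℕ} {θ : Fin n → ℝ} {w : Equiv.Perm (Fin n)} {i j : Fin n} {t : Tile n}

theorem isRightPerimeter_descentTile (hd : IsDescent w i j) :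
    (descentTile θ hd).IsRightPerimeter θ w := by
  refine ⟨i, hd.val_add_one ▸ j.2, ?_, ?_⟩
  · rw [pathEdge_eq_segment]
    exact Or.inr (Or.inl rfl)
  · rw [hd.val_add_one, pathEdge_eq_segment, ← hd.val_add_one, pathVertex_succ,
      add_right_comm]
    exact Or.inr (Or.inr (Or.inr rfl))

theorem Tile.subset_carrier_of_mem_edges {E : Set ℂ} (hE : E ∈ t.edges θ) : E ⊆ t.carrier θ := by
  have htop : t.top ∈ t.carrier θ := ⟨0, by simp, 0, by simp, by simp⟩
  have hlo : t.top + edgeVec θ t.lo ∈ t.carrier θ := ⟨1, by simp, 0, by simp, by simp⟩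
  have hhi : t.top + edgeVec θ t.hi ∈ t.carrier θ := ⟨0, by simp, 1, by simp, by simp⟩
  have hbot : t.top + edgeVec θ t.lo + edgeVec θ t.hi ∈ t.carrier θ :=
    ⟨1, by simp, 1, by simp, by simp⟩
  rcases hE with rfl | rfl | rfl | rfl
  exacts [t.convex_carrier.segment_subset htop hlo, t.convex_carrier.segment_subset htop hhi,
    t.convex_carrier.segment_subset hlo hbot, t.convex_carrier.segment_subset hhi hbot]

theorem Tile.exists_mem_labels_of_mem_edges {E : Set ℂ} (hE : E ∈ t.edges θ) :
    ∃ q, ∃ l ∈ t.labels, E = segment ℝ q (q + edgeVec θ l) := by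
  have hlo : t.lo ∈ t.labels := Finset.mem_insert_self _ _
  have hhi : t.hi ∈ t.labels := Finset.mem_insert_of_mem (Finset.mem_singleton_self _)
  rcases hE with rfl | rfl | rfl | rfl
  exacts [⟨_, _, hlo, rfl⟩, ⟨_, _, hhi, rfl⟩, ⟨_, _, hhi, rfl⟩,
    ⟨_, _, hlo, congrArg _ (add_right_comm _ _ _)⟩]

theorem IsAdmissible.apply_mem_labels_of_pathEdge_mem_edges (hθ : IsAdmissible θ)
    (hi : pathEdge θ w i ∈ t.edges θ) : w i ∈ t.labels := by
  obtain ⟨q, l, hl, heq⟩ := Tile.exists_mem_labels_of_mem_edges hi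
  obtain ⟨k, rfl⟩ := w.surjective l
  have hq : pathVertex θ w k = q :=
    hθ.pathVertex_eq_of_segment_subset_path w (heq ▸ pathEdge_subset_path w i)
  rw [← hq, ← pathEdge_eq_segment] at heq
  rwa [hθ.injective_pathEdge w heq]

theorem Tile.lo_eq_and_hi_eq_of_labels_eq {x y : Fin n} (ht : t.labels = {x, y}) (hyx : y < x) :
    t.lo = y ∧ t.hi = x := by
  have hlo : t.lo ∈ t.labels := Finset.mem_insert_self _ _
  have hhi : t.hi ∈ t.labels := Finset.mem_insert_of_mem (Finset.mem_singleton_self _)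
  have hlt := t.lo_lt_hi
  rw [ht, Finset.mem_insert, Finset.mem_singleton] at hlo hhi
  omega

theorem Tile.IsRightPerimeter.pathEdge_mem_edges (hθ : IsAdmissible θ)
    (ht : t.IsRightPerimeter θ w) (hlab : t.labels = {w i, w j}) (hij : (i : ℕ) + 1 = j) :
    pathEdge θ w i ∈ t.edges θ ∧ pathEdge θ w j ∈ t.edges θ := by
  obtain ⟨k, hk, hedge, hedge'⟩ := ht
  have hmem := hθ.apply_mem_labels_of_pathEdge_mem_edges (i := ⟨k, Nat.lt_of_succ_lt hk⟩) hedge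
  have hmem' := hθ.apply_mem_labels_of_pathEdge_mem_edges (i := ⟨k + 1, hk⟩) hedge'
  simp only [hlab, Finset.mem_insert, Finset.mem_singleton, EmbeddingLike.apply_eq_iff_eq,
    Fin.ext_iff] at hmem hmem'
  obtain rfl : k = i := by omega
  exact ⟨hedge, hij ▸ hedge'⟩

theorem FullySupported.exists_isRhombicTiling (hw : FullySupported w) (hn : 1 < n)
    (hθ : IsAdmissible θ) : ∃ T, IsRhombicTiling θ w T := by
  have : NeZero n := ⟨(one_pos.trans hn).ne'⟩
  obtain ⟨T, hT⟩ := hθ.exists_isWeakTiling w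
  exact ⟨T, hT.isRhombicTiling hθ (hw.polygon_subset_closure_interior hn hθ)⟩

theorem Tile.IsForcedRightPerimeter.not_isAvoidable (ht : t.IsForcedRightPerimeter θ w)
    (hw : FullySupported w) (hn : 1 < n) (hθ : IsAdmissible θ) : ¬ t.IsAvoidable θ w := by
  rintro ⟨T, hT, htT⟩
  exact htT (ht T (hT.isRhombicTiling hθ (hw.polygon_subset_closure_interior hn hθ))).1

theorem isForcedRightPerimeter_descentTile (hθ : IsAdmissible θ) (hd : IsDescent w i j)
    (hmax : IsLRMax w (w i)) (hmin : IsRLMin w (w j)) :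
    (descentTile θ hd).IsForcedRightPerimeter θ w := by
  have : NeZero n := ⟨i.pos.ne'⟩
  exact fun T hT =>
    ⟨hT.isWeakTiling.descentTile_mem hθ hd hmax hmin, isRightPerimeter_descentTile hd⟩

theorem Tile.IsForcedRightPerimeter.isLRMax_and_isRLMin (ht : t.IsForcedRightPerimeter θ w)
    (hθ : IsAdmissible θ) (hw : FullySupported w) (hd : IsDescent w i j)
    (hlab : t.labels = {w i, w j}) : IsLRMax w (w i) ∧ IsRLMin w (w j) := by
  have : NeZero n := ⟨i.pos.ne'⟩
  have hn : 1 < n := by have := hd.val_add_one; omega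
  obtain ⟨hlo, hhi⟩ := Tile.lo_eq_and_hi_eq_of_labels_eq hlab hd.lt
  obtain ⟨T, hT⟩ := hw.exists_isRhombicTiling hn hθ
  obtain ⟨hi, hj⟩ := (ht T hT).2.pathEdge_mem_edges hθ hlab hd.val_add_one
  have hforced := ht.not_isAvoidable hw hn hθ
  refine ⟨isLRMax_apply_iff.2 fun l hl => ?_, isRLMin_apply_iff.2 fun l hl => ?_⟩
  · exact (w.injective.ne hl.ne).lt_of_le <| not_lt.1 fun hlt =>
      hforced (t.isAvoidable_of_lt_apply hθ hl hlt hhi (t.subset_carrier_of_mem_edges hi))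
  · exact (w.injective.ne hl.ne).lt_of_le <| not_lt.1 fun hlt =>
      hforced (t.isAvoidable_of_apply_lt hθ hl hlt hlo (t.subset_carrier_of_mem_edges hj))

theorem FullySupported.hasForcedRightPerimeterTile_iff (hw : FullySupported w)
    (hθ : IsAdmissible θ) (hd : IsDescent w i j) :
    HasForcedRightPerimeterTile θ w (w i) (w j) ↔ IsLRMax w (w i) ∧ IsRLMin w (w j) := by
  constructor
  · rintro ⟨t, hlab, ht⟩
    exact ht.isLRMax_and_isRLMin hθ hw hd hlab
  · rintro ⟨hmax, hmin⟩
    exact ⟨descentTile θ hd, Finset.pair_comm _ _,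
      isForcedRightPerimeter_descentTile hθ hd hmax hmin⟩

end RightPerimeter

end Elnitsky

end

theorem theorem4 (n : ℕ) (θ : Fin n → ℝ) (hθ : Elnitsky.IsAdmissible θ)
    (w : Equiv.Perm (Fin n)) (hw : Elnitsky.FullySupported w)
    (k : ℕ) (hk : k + 1 < n) (x y : Fin n)
    (hx : w ⟨k, Nat.lt_of_succ_lt hk⟩ = x) (hy : w ⟨k + 1, hk⟩ = y) (hxy : y < x) :
    (Elnitsky.HasForcedRightPerimeterTile θ w x y ↔ ¬ Elnitsky.TogetherIn321 w x y) ∧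
    (Elnitsky.HasForcedRightPerimeterTile θ w x y ↔
      Elnitsky.IsLRMax w x ∧ Elnitsky.IsRLMin w y) := by
  subst hx hy
  have hd : Elnitsky.IsDescent w ⟨k, Nat.lt_of_succ_lt hk⟩ ⟨k + 1, hk⟩ := ⟨rfl, hxy⟩
  rw [Elnitsky.not_togetherIn321_iff hd, and_self]
  exact hw.hasForcedRightPerimeterTile_iff hθ hd
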